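/- Let $0<\alpha,\beta<1$, $0<\gamma\le 1$ with $\alpha+\beta+\gamma>2$, and put $a=\frac{\alpha+\beta-\gamma}{2}$, $b=\frac{\alpha+\beta+\gamma-2}{2}$, $c=\alpha$. Let $F(a,b,c;z)$ be the Gaussian hypergeometric function, continued analytically to $\mathbb C\setminus[1,+\infty)$, let $\varphi_1(z)=F(a,b,c;z)$, $\varphi_2(z)=F(a,b,a+b-c+1;1-z)$, and $$K_1=-\frac{\Gamma(c-a)\Gamma(c-b)}{\Gamma(c)\Gamma(c-a-b)},\quad K_2=-\frac{\Gamma(a+1-c)\Gamma(b+1-c)}{\Gamma(1-c)\Gamma(a+b+1-c)},\quad K_3=\sqrt{\frac{\sin(\pi a)\sin(\pi b)}{\sin(\pi(c-a))\sin(\pi(c-b))}}\cdot\frac{\Gamma(a+b+1-c)\Gamma(c)}{\Gamma(a)\Gamma(b)}.$$ Let $\lambda=\lambda_{\alpha,\beta,\gamma}$ be the generalized hyperbolic density on $\mathbb C\setminus\{0,1\}$ with conical singularities of orders $\alpha,\beta,\gamma$ at $0,1,\infty$, $$\lambda(z)=\frac{1}{|z|^{\alpha}|1-z|^{\beta}}\cdot\frac{K_3}{K_1|\varphi_1(z)|^2+K_2|\varphi_2(z)|^2+2\,\mathrm{Re}(\varphi_1(z)\varphi_2(\bar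 z))}$$ (extended continuously across the cuts $(-\infty,0)$ and $(1,+\infty)$), and let $v(z)=\log\lambda(z)+\alpha\log|z|$. Write $\partial=\partial/\partial z$, $\bar\partial=\partial/\partial\bar z$ and $(c)_0=1$, $(c)_k=c(c+1)\cdots(c+k-1)$. Put $$L=\frac{K_2^2}{K_1K_2-1}\left(\frac{\Gamma(c)\Gamma(a+b-c+1)}{\Gamma(a)\Gamma(b)}\right)^2 .$$ Then $\lambda>0$ and $v$ is $C^\infty$ in a punctured neighbourhood of $0$, $K_1K_2\ne1$, $L\neq 0$, and: (i) if $0<\alpha<\frac12$, then $\displaystyle\lim_{z\to0}\partial v(z)=\frac{\beta}{2}-\frac{ab}{c}$; (ii) if $\alpha=\frac12$, then $\displaystyle\partial v(z)=\frac{\beta}{2}-2ab-2L\,\frac{\bar z}{|z|}+O(|z|^{1/2})$ as $z\to0$; (iii) $\displaystyle\lim_{z\to0}z^n|z|^{2\alpha-2}\partial^n v(z)=\frac{(-1)^{n}(c)_{n-1}}{1-c}\,L$ for all $n\ge2$ if $0<\alpha\le\frac12$, and for all $n\ge1$ if $\frac12<\alpha<1$; (iv) $\displaystyle\lim_{z\to0}\bar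 z^m z^n|z|^{2\alpha-2}\bar\partial^m\partial^n v(z)=(-1)^{m+n+1}(c)_{n-1}(c)_{m-1}\,L$ for all $m,n\ge1$ and all $0<\alpha<1$. Since $L\ne0$, the limits in (iii) and (iv) do not vanish, so in those cases the general bounds $O(|z|^{2-2\alpha-n})$ (with $n$ the total order of differentiation) cannot be improved. -/

import Mathlib

open Filter Topology
open scoped ContDiff

noncomputable section

/-- The Gaussian hypergeometric function `F(a,b,c;z)`: the holomorphic function on the slit plane
`ℂ ∖ [1, +∞)` that agrees with the hypergeometric series on the unit disc. By the identity theorem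
it is unique on the slit plane; its values on the cut are irrelevant. -/
def hypF (a b c : ℂ) : ℂ → ℂ :=
  open Classical in
  if h : ∃ f : ℂ → ℂ, DifferentiableOn ℂ f {z | 1 - z ∈ Complex.slitPlane} ∧
      Set.EqOn f (ordinaryHypergeometric a b c) (Metric.ball 0 1)
  then h.choose else ordinaryHypergeometric a b c

/-- The parameter `a = (α + β - γ) / 2`. -/
def parA (α β γ : ℝ) : ℝ := (α + β - γ) / 2

/-- The parameter `b = (α + β + γ - 2) / 2`. -/
def parB (α β γ : ℝ) : ℝ := (α + β + γ - 2) / 2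

/-- `K₁ = - Γ(c-a) Γ(c-b) / (Γ(c) Γ(c-a-b))`. -/
def K₁ (a b c : ℝ) : ℝ :=
  -(Real.Gamma (c - a) * Real.Gamma (c - b) / (Real.Gamma c * Real.Gamma (c - a - b)))

/-- `K₂ = - Γ(a+1-c) Γ(b+1-c) / (Γ(1-c) Γ(a+b+1-c))`. -/
def K₂ (a b c : ℝ) : ℝ :=
  -(Real.Gamma (a + 1 - c) * Real.Gamma (b + 1 - c) /
    (Real.Gamma (1 - c) * Real.Gamma (a + b + 1 - c)))

/-- `K₃`. -/
def K₃ (a b c : ℝ) : ℝ :=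
  √(Real.sin (Real.pi * a) * Real.sin (Real.pi * b) /
      (Real.sin (Real.pi * (c - a)) * Real.sin (Real.pi * (c - b)))) *
    (Real.Gamma (a + b + 1 - c) * Real.Gamma c / (Real.Gamma a * Real.Gamma b))

/-- `φ₁(z) = F(a, b, c; z)`. -/
def φ₁ (a b c : ℝ) (z : ℂ) : ℂ := hypF a b c z

/-- `φ₂(z) = F(a, b, a + b - c + 1; 1 - z)`. -/
def φ₂ (a b c : ℝ) (z : ℂ) : ℂ := hypF a b (a + b - c + 1) (1 - z)

/-- `M(z) = K₁ |φ₁(z)|² + K₂ |φ₂(z)|² + 2 Re (φ₁(z) φ₂(z̄))`. -/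
def hypM (a b c : ℝ) (z : ℂ) : ℝ :=
  K₁ a b c * ‖φ₁ a b c z‖ ^ 2 + K₂ a b c * ‖φ₂ a b c z‖ ^ 2 +
    2 * (φ₁ a b c z * φ₂ a b c (starRingEnd ℂ z)).re

/-- The doubly slit plane `ℂ ∖ ((-∞, 0] ∪ [1, +∞))`, on which `φ₁` and `φ₂` are holomorphic. -/
def doubleSlit : Set ℂ := {z | z ∈ Complex.slitPlane ∧ 1 - z ∈ Complex.slitPlane}

/-- The right-hand side `|z|^{-α} |1-z|^{-β} K₃ / M(z)` of the explicit formula for the density. -/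
def densityFormula (α β γ : ℝ) (z : ℂ) : ℝ :=
  1 / (‖z‖ ^ α * ‖1 - z‖ ^ β) *
    (K₃ (parA α β γ) (parB α β γ) α / hypM (parA α β γ) (parB α β γ) α z)

/-- The generalized hyperbolic density `λ_{α,β,γ}` on `ℂ ∖ {0, 1}`: it is given by the explicit
formula on the doubly slit plane and is extended by continuity across the two cuts `(-∞, 0)` and
`(1, +∞)`, where the principal branches of `φ₂` and `φ₁` jump but the formula does not. -/
def hypDensity (α β γ : ℝ) : ℂ → ℝ := extendFrom doubleSlit (densityFormula α β γ)

/-- The remainder `v`, i.e. `log λ(z) = - α log |z| + v(z)`. -/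
def remV (α β γ : ℝ) (z : ℂ) : ℝ :=
  Real.log (hypDensity α β γ z) + α * Real.log ‖z‖

/-- The Wirtinger derivative `∂ = ∂/∂z = (∂/∂x - i ∂/∂y) / 2`. -/
def dz (f : ℂ → ℂ) (z : ℂ) : ℂ :=
  (fderiv ℝ f z 1 - Complex.I * fderiv ℝ f z Complex.I) / 2

/-- The Wirtinger derivative `∂̄ = ∂/∂z̄ = (∂/∂x + i ∂/∂y) / 2`. -/
def dzbar (f : ℂ → ℂ) (z : ℂ) : ℂ :=
  (fderiv ℝ f z 1 + Complex.I * fderiv ℝ f z Complex.I) / 2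

/-- The constant `K₂² / (K₁ K₂ - 1) * (Γ(c) Γ(a+b-c+1) / (Γ(a) Γ(b)))²`. -/
def constL (a b c : ℝ) : ℝ :=
  K₂ a b c ^ 2 / (K₁ a b c * K₂ a b c - 1) *
    (Real.Gamma c * Real.Gamma (a + b - c + 1) / (Real.Gamma a * Real.Gamma b)) ^ 2

end

/-! Put s = 1 - c. The hypotheses give a, b > 0, a + b < c < 1 and a + b - c + 1 = β. At 0 the
hypergeometric equation has the solutions f = F(a, b, c; z) and z^s g with g = F(a - c + 1, b - c +
1, 2 - c; z), and the connection formula reads φ₂ = A f - B z^s g with Gamma quotients A and B.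
Since K₂ A = -1, the cross term in f and z^s g cancels from M, which leaves M = P |f|² + Q |z|^(2s)
|g|² (`hypM_eq`), a single-valued expression around 0. A Gamma reflection identity gives K₁ K₂ < 1,
hence P > 0, and Q / P = L / s². Therefore v = Re H - log(1 + u) near 0, with H holomorphic, H'(0) =
β - 2ab/c, and u = (L / s²) |z|^(2s) |g/f|².

To differentiate u arbitrarily often, t = |z|^(2s) is treated as an independent real variable: one
works with functions z^(-n) z̄^(-m) t Φ(z, t), Φ real-analytic at the origin. This class is stable
under ∂ and ∂̄, which multiply the leading coefficient Φ(0) by s - n and s - m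
(`HasNormPowForm.dz_dzbar`); iteration produces the Pochhammer symbols of 1 - s = c. Thus ∂v = H'/2
- R with R of size |z|^(2s-1) and leading coefficient L / s. The holomorphic term decides the limit
when s > 1/2, both terms count when s = 1/2, and R dominates when s < 1/2 or after at least one more
∂. Any ∂̄ removes H' altogether, so (iv) needs no case distinction.

The connection formula rests on two facts. Weighted Wronskians of solutions are constant, so A and B
exist (`exists_gaussF_connection`); Gauss's value of F at 1, obtained from Euler's integral
(`tendsto_ordinaryHypergeometric_one`), then determines them by letting z tend to 0 and to 1.
Euler's integral also provides the analytic continuation hidden in `hypF`. -/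

noncomputable section

/-! ### Euler's integral, analytic continuation and Gauss's theorem at 1 -/

open MeasureTheory Set

/-- The density `t ^ (u - 1) * (1 - t) ^ (v - 1)` of the beta integral. -/
def betaWeight (u v t : ℝ) : ℝ := t ^ (u - 1) * (1 - t) ^ (v - 1)

theorem betaWeight_nonneg (u v : ℝ) {t : ℝ} (ht : t ∈ Ioo (0 : ℝ) 1) : 0 ≤ betaWeight u v t :=
  mul_nonneg (Real.rpow_nonneg ht.1.le _) (Real.rpow_nonneg (sub_nonneg.2 ht.2.le) _)

theorem ofReal_betaWeight (u v : ℝ) {t : ℝ} (ht : t ∈ Ioo (0 : ℝ) 1) :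
    (betaWeight u v t : ℂ) = (t : ℂ) ^ ((u : ℂ) - 1) * (1 - (t : ℂ)) ^ ((v : ℂ) - 1) := by
  rw [betaWeight, Complex.ofReal_mul, Complex.ofReal_cpow ht.1.le,
    Complex.ofReal_cpow (sub_nonneg.2 ht.2.le)]
  push_cast
  rfl

theorem integrableOn_betaWeight {u v : ℝ} (hu : 0 < u) (hv : 0 < v) :
    IntegrableOn (betaWeight u v) (Ioo 0 1) := by
  have h := Complex.betaIntegral_convergent (u := u) (v := v) (by simpa) (by simpa)
  rw [intervalIntegrable_iff_integrableOn_Ioo_of_le zero_le_one] at h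
  have h2 := h.re
  refine IntegrableOn.congr_fun h2 (fun t ht => ?_) measurableSet_Ioo
  simp only [← ofReal_betaWeight u v ht]
  simp

theorem integral_betaWeight {u v : ℝ} (hu : 0 < u) (hv : 0 < v) :
    ∫ t in Ioo (0 : ℝ) 1, betaWeight u v t = ProbabilityTheory.beta u v := by
  rw [ProbabilityTheory.beta_eq_betaIntegralReal u v hu hv, Complex.betaIntegral,
    intervalIntegral.integral_of_le zero_le_one, integral_Ioc_eq_integral_Ioo,
    ← setIntegral_congr_fun measurableSet_Ioo (fun t ht => ofReal_betaWeight u v ht),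
    integral_complex_ofReal, Complex.ofReal_re]

/-- Euler's integral for the hypergeometric function, up to a constant factor. -/
def eulerIntegral (a b c : ℝ) (z : ℂ) : ℂ :=
  ∫ t in Ioo (0 : ℝ) 1, (betaWeight b (c - b) t : ℂ) * (1 - z * t) ^ (-(a : ℂ))

/-- The slit plane is star-shaped about 1, and 1 - zt lies on the segment from 1 to 1 - z. Hence the
principal power in Euler's integrand is holomorphic in z. -/
theorem one_sub_mul_mem_slitPlane {z : ℂ} (hz : 1 - z ∈ Complex.slitPlane) {t : ℝ}
    (ht : t ∈ Icc (0 : ℝ) 1) : 1 - z * t ∈ Complex.slitPlane := by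
  have := Complex.starConvex_one_slitPlane.add_smul_mem (y := -z)
    (by simpa [sub_eq_add_neg] using hz) ht.1 ht.2
  convert this using 1
  simp [sub_eq_add_neg, mul_comm]

theorem isOpen_one_sub_slitPlane : IsOpen {z : ℂ | 1 - z ∈ Complex.slitPlane} :=
  Complex.isOpen_slitPlane.preimage (by fun_prop)

theorem continuousOn_euler_kernel (a : ℂ) :
    ContinuousOn (fun p : ℂ × ℝ => (1 - p.1 * p.2) ^ a)
      ({z : ℂ | 1 - z ∈ Complex.slitPlane} ×ˢ Icc (0 : ℝ) 1) := by
  intro p hp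
  refine ContinuousAt.continuousWithinAt ?_
  refine ContinuousAt.cpow (by fun_prop) continuousAt_const ?_
  exact one_sub_mul_mem_slitPlane hp.1 hp.2

theorem integrableOn_betaWeight_mul_kernel {u v : ℝ} (hu : 0 < u) (hv : 0 < v) (a : ℂ) {z : ℂ}
    (hz : 1 - z ∈ Complex.slitPlane) :
    IntegrableOn (fun t : ℝ => (betaWeight u v t : ℂ) * (1 - z * t) ^ a) (Ioo 0 1) := by
  have hc : ContinuousOn (fun t : ℝ => (1 - z * t) ^ a) (Icc 0 1) :=
    (continuousOn_euler_kernel a).comp (f := fun t : ℝ => (z, t)) (by fun_prop)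
      (fun t ht => ⟨hz, ht⟩)
  obtain ⟨C, hC⟩ := isCompact_Icc.exists_bound_of_continuousOn hc
  refine Integrable.mul_bdd (c := C) (integrableOn_betaWeight hu hv).ofReal ?_ ?_
  · exact (hc.mono Ioo_subset_Icc_self).aestronglyMeasurable measurableSet_Ioo
  · exact ae_restrict_of_forall_mem measurableSet_Ioo fun t ht => hC t (Ioo_subset_Icc_self ht)

theorem differentiableOn_eulerIntegral {a b c : ℝ} (hb : 0 < b) (hcb : b < c) :
    DifferentiableOn ℂ (eulerIntegral a b c) {z | 1 - z ∈ Complex.slitPlane} := by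
  intro z₀ hz₀
  obtain ⟨r, hr, hball⟩ := Metric.nhds_basis_closedBall.mem_iff.1
    (isOpen_one_sub_slitPlane.mem_nhds hz₀)
  have hcompact := (isCompact_closedBall z₀ r).prod (isCompact_Icc (a := (0 : ℝ)) (b := 1))
  -- C bounds the z-derivative of the kernel on a compact product; the endpoint singularities sit
  -- entirely in the integrable beta weight.
  obtain ⟨C, hC⟩ := hcompact.exists_bound_of_continuousOn
    (ContinuousOn.mul (f := fun p : ℂ × ℝ => (a : ℂ) * (p.2 : ℂ)) (by fun_prop)
      ((continuousOn_euler_kernel (-(a : ℂ) - 1)).mono (prod_mono hball subset_rfl)))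
  have hcb' : 0 < c - b := sub_pos.2 hcb
  have key := hasDerivAt_integral_of_dominated_loc_of_deriv_le (μ := volume.restrict (Ioo (0 : ℝ) 1))
    (F := fun z t => (betaWeight b (c - b) t : ℂ) * (1 - z * t) ^ (-(a : ℂ)))
    (F' := fun z t => (betaWeight b (c - b) t : ℂ) * ((a : ℂ) * t * (1 - z * t) ^ (-(a : ℂ) - 1)))
    (x₀ := z₀) (s := Metric.closedBall z₀ r) (bound := fun t => betaWeight b (c - b) t * C)
    (Metric.closedBall_mem_nhds z₀ hr) ?_ ?_ ?_ ?_ ?_ ?_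
  · exact key.2.differentiableAt.differentiableWithinAt
  · filter_upwards [isOpen_one_sub_slitPlane.mem_nhds hz₀] with z hz
    exact (integrableOn_betaWeight_mul_kernel hb hcb' _ hz).aestronglyMeasurable
  · exact integrableOn_betaWeight_mul_kernel hb hcb' _ hz₀
  · have h := (integrableOn_betaWeight_mul_kernel hb hcb' (-(a : ℂ) - 1) hz₀).aestronglyMeasurable
    have h2 : AEStronglyMeasurable (fun t : ℝ => (a : ℂ) * t) (volume.restrict (Ioo (0 : ℝ) 1)) :=
      Continuous.aestronglyMeasurable (by fun_prop)
    refine (h2.mul h).congr (Eventually.of_forall fun t => ?_)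
    simp only [Pi.mul_apply]
    ring
  · refine ae_restrict_of_forall_mem measurableSet_Ioo fun t ht z hz => ?_
    rw [norm_mul, Complex.norm_real, Real.norm_of_nonneg (betaWeight_nonneg _ _ ht)]
    refine mul_le_mul_of_nonneg_left ?_ (betaWeight_nonneg _ _ ht)
    exact hC (z, t) ⟨hz, Ioo_subset_Icc_self ht⟩
  · exact (integrableOn_betaWeight hb hcb').mul_const C
  · refine ae_restrict_of_forall_mem measurableSet_Ioo fun t ht z hz => ?_
    refine HasDerivAt.const_mul _ ?_
    have hslit := one_sub_mul_mem_slitPlane (hball hz) (Ioo_subset_Icc_self ht)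
    have h1 : HasDerivAt (fun z : ℂ => 1 - z * t) (-(t : ℂ)) z := by
      simpa using ((hasDerivAt_id z).mul_const (t : ℂ)).const_sub 1
    have h2 := h1.cpow_const (c := -(a : ℂ)) hslit
    rw [show (a : ℂ) * t * (1 - z * t) ^ (-(a : ℂ) - 1) =
      -(a : ℂ) * (1 - z * t) ^ (-(a : ℂ) - 1) * -(t : ℂ) by ring]
    exact h2

/-- The moments of the beta weight supply the factor (b)_n / (c)_n of the hypergeometric
coefficients. -/
theorem ascPochhammer_eval_mul_beta {b c : ℝ} (hb : 0 < b) (hcb : b < c) (n : ℕ) :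
    ProbabilityTheory.beta (b + n) (c - b) =
      ProbabilityTheory.beta b (c - b) * ((ascPochhammer ℝ n).eval b / (ascPochhammer ℝ n).eval c) := by
  have hG (x : ℝ) (hx : 0 < x) :
      Real.Gamma (x + n) = Real.Gamma x * (ascPochhammer ℝ n).eval x := by
    induction n with
    | zero => simp
    | succ n ih =>
      rw [ascPochhammer_succ_eval, Nat.cast_succ, ← add_assoc, Real.Gamma_add_one (by positivity), ih]
      ring
  have hc : 0 < c := hb.trans hcb
  have h1 := (ascPochhammer_pos n c hc).ne'
  have h2 := (Real.Gamma_pos_of_pos hc).ne'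
  rw [ProbabilityTheory.beta, ProbabilityTheory.beta, hG b hb,
    show b + n + (c - b) = c + n by ring, hG c hc, show b + (c - b) = c by ring]
  field_simp

theorem HasSum.of_forall_eq {f g : ℕ → ℂ} {x : ℂ} (hg : HasSum g x) (h : ∀ n, f n = g n) :
    HasSum f x := (funext h : f = g) ▸ hg

theorem ofReal_ascPochhammer_eval (n : ℕ) (x : ℝ) :
    (((ascPochhammer ℝ n).eval x : ℝ) : ℂ) = (ascPochhammer ℂ n).eval (x : ℂ) := by
  rw [← ascPochhammer_map Complex.ofRealHom, Polynomial.eval_map,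
    ← Complex.ofRealHom_eq_coe x, Polynomial.eval₂_at_apply]
  rfl

/-- The binomial series in Pochhammer form. -/
theorem hasSum_one_sub_cpow_neg (a : ℂ) {z : ℂ} (hz : ‖z‖ < 1) :
    HasSum (fun n : ℕ => ((n.factorial : ℂ)⁻¹ * (ascPochhammer ℂ n).eval a) * z ^ n)
      ((1 - z) ^ (-a)) := by
  have h := (Complex.one_add_cpow_hasFPowerSeriesOnBall_zero (a := -a)).hasSum (y := -z)
    (by simpa [enorm_eq_nnnorm, ← NNReal.coe_lt_one] using hz)
  -- The auxiliary parameter occurs both above and below in the hypergeometric coefficient and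
  -- cancels; 1 is an admissible choice.
  rw [binomialSeries_eq_ordinaryHypergeometricSeries (b := (1 : ℂ))
    (by intro k hk; have := congrArg Complex.re hk; simp at this; linarith [k.cast_nonneg (α := ℝ)]),
    zero_add, ← sub_eq_add_neg] at h
  refine h.of_forall_eq fun n => ?_
  rw [FormalMultilinearSeries.compContinuousLinearMap_apply]
  have h1 : ((ascPochhammer ℂ n).eval (1 : ℂ)) ≠ 0 := by
    rw [ascPochhammer_eval_one]; exact_mod_cast n.factorial_ne_zero
  have h2 : (⇑(-ContinuousLinearMap.id ℂ ℂ) ∘ fun _ : Fin n => -z) = fun _ => z := by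
    ext; simp
  rw [h2, ordinaryHypergeometricSeries_apply_eq, neg_neg, mul_assoc _ _ (_⁻¹), mul_inv_cancel₀ h1,
    mul_one, smul_eq_mul]

/-- Expand (1 - zt)^(-a) by the binomial series and integrate termwise. The interchange is justified
because the moments decrease in n, so the absolutely convergent binomial series at z, times the
total mass, is a majorant. -/
theorem hasSum_eulerIntegral (a : ℝ) {b c : ℝ} (hb : 0 < b) (hcb : b < c) {z : ℂ} (hz : ‖z‖ < 1) :
    HasSum (fun n : ℕ => (ProbabilityTheory.beta b (c - b) : ℂ) *
      (ordinaryHypergeometricCoefficient (a : ℂ) b c n * z ^ n)) (eulerIntegral a b c z) := by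
  have hcb' : 0 < c - b := sub_pos.2 hcb
  set q : ℕ → ℂ := fun n => (n.factorial : ℂ)⁻¹ * (ascPochhammer ℂ n).eval (a : ℂ) with hq
  have hw (n : ℕ) : IntegrableOn (betaWeight (b + n) (c - b)) (Ioo 0 1) :=
    integrableOn_betaWeight (by positivity) hcb'
  have hpow (n : ℕ) {t : ℝ} (ht : t ∈ Ioo (0 : ℝ) 1) :
      betaWeight (b + n) (c - b) t = betaWeight b (c - b) t * t ^ n := by
    rw [betaWeight, betaWeight, show b + n - 1 = b - 1 + n by ring, Real.rpow_add ht.1,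
      Real.rpow_natCast]
    ring
  have hmono (n : ℕ) : ProbabilityTheory.beta (b + n) (c - b) ≤ ProbabilityTheory.beta b (c - b) := by
    rw [← integral_betaWeight (by positivity) hcb', ← integral_betaWeight hb hcb']
    refine setIntegral_mono_on (hw n) (integrableOn_betaWeight hb hcb') measurableSet_Ioo ?_
    intro t ht
    rw [hpow n ht]
    exact mul_le_of_le_one_right (betaWeight_nonneg _ _ ht) (pow_le_one₀ ht.1.le ht.2.le)
  have key := hasSum_integral_of_summable_integral_norm (μ := volume.restrict (Ioo (0 : ℝ) 1))
    (F := fun n t => q n * z ^ n * (betaWeight (b + n) (c - b) t : ℂ)) ?_ ?_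
  · have hE : eulerIntegral a b c z = ∫ t in Ioo (0 : ℝ) 1,
        ∑' n : ℕ, q n * z ^ n * (betaWeight (b + n) (c - b) t : ℂ) := ?_
    rw [hE]
    · refine key.of_forall_eq fun n => ?_
      rw [integral_const_mul, integral_complex_ofReal, integral_betaWeight (by positivity) hcb',
        ascPochhammer_eval_mul_beta hb hcb]
      push_cast
      rw [ofReal_ascPochhammer_eval, ofReal_ascPochhammer_eval, hq, ordinaryHypergeometricCoefficient]
      ring
    · refine setIntegral_congr_fun measurableSet_Ioo fun t ht => ?_
      have hzt : ‖z * t‖ < 1 := by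
        rw [norm_mul, Complex.norm_real, Real.norm_of_nonneg ht.1.le]
        nlinarith [norm_nonneg z, ht.1, ht.2]
      have h := (hasSum_one_sub_cpow_neg (a : ℂ) hzt).mul_left (betaWeight b (c - b) t : ℂ)
      rw [← h.tsum_eq]
      refine tsum_congr fun n => ?_
      rw [hpow n ht, hq]
      push_cast
      ring
  · intro n
    exact (hw n).ofReal.const_mul _
  · have hsum := (hasSum_one_sub_cpow_neg (a : ℂ) hz).summable.norm.mul_right
      (ProbabilityTheory.beta b (c - b))
    refine Summable.of_nonneg_of_le (fun n => integral_nonneg fun _ => norm_nonneg _) (fun n => ?_)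
      hsum
    simp only [norm_mul (q n * z ^ n)]
    rw [integral_const_mul]
    refine mul_le_mul_of_nonneg_left ?_ (norm_nonneg _)
    refine le_trans (le_of_eq ?_) (hmono n)
    rw [← integral_betaWeight (by positivity) hcb']
    refine setIntegral_congr_fun measurableSet_Ioo fun t ht => ?_
    simp only [Complex.norm_real, Real.norm_of_nonneg (betaWeight_nonneg _ _ ht)]

theorem ordinaryHypergeometric_eq_eulerIntegral (a : ℝ) {b c : ℝ} (hb : 0 < b) (hcb : b < c) {z : ℂ}
    (hz : ‖z‖ < 1) :
    ordinaryHypergeometric (a : ℂ) b c z =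
      (ProbabilityTheory.beta b (c - b) : ℂ)⁻¹ * eulerIntegral a b c z := by
  have hB : (ProbabilityTheory.beta b (c - b) : ℂ) ≠ 0 :=
    Complex.ofReal_ne_zero.2 (ProbabilityTheory.beta_pos hb (sub_pos.2 hcb)).ne'
  have h := (hasSum_eulerIntegral a hb hcb hz).mul_left (ProbabilityTheory.beta b (c - b) : ℂ)⁻¹
  simp only [inv_mul_cancel_left₀ hB] at h
  rw [← h.tsum_eq, ordinaryHypergeometric_eq_tsum]
  rfl

/-- Gauss's summation theorem as a one-sided limit. In Euler's integral, a ≥ 0 gives (1 - xt)^(-a) ≤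
(1 - t)^(-a), so the limiting integrand dominates; it is again a beta weight, integrable because a +
b < c. -/
theorem tendsto_ordinaryHypergeometric_one {a b c : ℝ} (ha : 0 ≤ a) (hb : 0 < b)
    (hab : a + b < c) :
    Tendsto (fun x : ℝ => ordinaryHypergeometric (a : ℂ) b c (x : ℂ)) (𝓝[<] 1)
      (𝓝 ((Real.Gamma c * Real.Gamma (c - a - b) /
        (Real.Gamma (c - a) * Real.Gamma (c - b)) : ℝ) : ℂ)) := by
  have hcb : b < c := by linarith
  have hcb' : 0 < c - b := sub_pos.2 hcb
  have hcab : 0 < c - b - a := by linarith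
  have hint : Tendsto (fun x : ℝ => eulerIntegral a b c x) (𝓝[<] 1)
      (𝓝 (ProbabilityTheory.beta b (c - b - a) : ℂ)) := by
    rw [← integral_betaWeight hb hcab, ← integral_complex_ofReal]
    have hval {t : ℝ} (ht : t ∈ Ioo (0 : ℝ) 1) :
        betaWeight b (c - b - a) t = betaWeight b (c - b) t * (1 - t) ^ (-a) := by
      rw [betaWeight, betaWeight, show c - b - a - 1 = c - b - 1 + -a by ring,
        Real.rpow_add (sub_pos.2 ht.2), mul_assoc]
    have hev : ∀ᶠ x : ℝ in 𝓝[<] 1, x ∈ Ioo (0 : ℝ) 1 := Ioo_mem_nhdsLT zero_lt_one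
    refine tendsto_integral_filter_of_dominated_convergence
      (bound := betaWeight b (c - b - a)) ?_ ?_ (integrableOn_betaWeight hb hcab) ?_
    · filter_upwards [hev] with x hx
      refine (integrableOn_betaWeight_mul_kernel hb hcb' _ ?_).aestronglyMeasurable
      rw [← Complex.ofReal_one, ← Complex.ofReal_sub, Complex.ofReal_mem_slitPlane]
      linarith [hx.2]
    · filter_upwards [hev] with x hx
      refine ae_restrict_of_forall_mem measurableSet_Ioo fun t ht => ?_
      have h0 : 0 < 1 - t := sub_pos.2 ht.2
      have h1 : 1 - t ≤ 1 - x * t := by nlinarith [hx.1, hx.2, ht.1, ht.2]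
      have h2 : (1 - (x : ℂ) * t) ^ (-(a : ℂ)) = (((1 - x * t) ^ (-a) : ℝ) : ℂ) := by
        rw [Complex.ofReal_cpow (h0.le.trans h1)]
        push_cast
        rfl
      rw [h2, ← Complex.ofReal_mul, Complex.norm_real, Real.norm_of_nonneg (mul_nonneg
        (betaWeight_nonneg _ _ ht) (Real.rpow_nonneg (h0.le.trans h1) _)), hval ht]
      exact mul_le_mul_of_nonneg_left (Real.rpow_le_rpow_of_nonpos h0 h1 (neg_nonpos.2 ha))
        (betaWeight_nonneg _ _ ht)
    · refine ae_restrict_of_forall_mem measurableSet_Ioo fun t ht => ?_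
      have h0 : 0 < 1 - t := sub_pos.2 ht.2
      rw [hval ht, Complex.ofReal_mul, Complex.ofReal_cpow h0.le]
      refine Tendsto.const_mul _ ?_
      have hc : ContinuousAt (fun x : ℝ => (1 - (x : ℂ) * t) ^ (-(a : ℂ))) 1 := by
        refine ContinuousAt.cpow (by fun_prop) continuousAt_const ?_
        rw [Complex.ofReal_one, one_mul, ← Complex.ofReal_one, ← Complex.ofReal_sub,
          Complex.ofReal_mem_slitPlane]
        exact h0
      have := hc.tendsto.mono_left (nhdsWithin_le_nhds (s := Iio (1 : ℝ)))
      simpa using this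
  have h := hint.const_mul (ProbabilityTheory.beta b (c - b) : ℂ)⁻¹
  have hval : ((Real.Gamma c * Real.Gamma (c - a - b) /
      (Real.Gamma (c - a) * Real.Gamma (c - b)) : ℝ) : ℂ) =
      (ProbabilityTheory.beta b (c - b) : ℂ)⁻¹ * (ProbabilityTheory.beta b (c - b - a) : ℂ) := by
    norm_cast
    have h1 := (Real.Gamma_pos_of_pos hb).ne'
    have h2 := (Real.Gamma_pos_of_pos hcb').ne'
    have h3 := (Real.Gamma_pos_of_pos (hb.trans hcb)).ne'
    have h4 := (Real.Gamma_pos_of_pos (show 0 < c - a by linarith)).ne'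
    rw [ProbabilityTheory.beta, ProbabilityTheory.beta, show b + (c - b) = c by ring,
      show b + (c - b - a) = c - a by ring, show c - b - a = c - a - b by ring]
    field_simp
  rw [hval]
  refine h.congr' ?_
  filter_upwards [Ioo_mem_nhdsLT (zero_lt_one (α := ℝ))] with x hx
  refine (ordinaryHypergeometric_eq_eulerIntegral a hb hcb ?_).symm
  rw [Complex.norm_real, Real.norm_of_nonneg hx.1.le]
  exact hx.2

/-- The normalised Euler integral witnesses the existence statement in the definition of `hypF`, so
the chosen function really is the continuation. -/
theorem hypF_spec (a : ℝ) {b c : ℝ} (hb : 0 < b) (hcb : b < c) :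
    DifferentiableOn ℂ (hypF a b c) {z | 1 - z ∈ Complex.slitPlane} ∧
      EqOn (hypF a b c) (ordinaryHypergeometric (a : ℂ) b c) (Metric.ball 0 1) := by
  have h : ∃ f : ℂ → ℂ, DifferentiableOn ℂ f {z | 1 - z ∈ Complex.slitPlane} ∧
      EqOn f (ordinaryHypergeometric (a : ℂ) b c) (Metric.ball 0 1) := by
    refine ⟨fun z => (ProbabilityTheory.beta b (c - b) : ℂ)⁻¹ * eulerIntegral a b c z,
      (differentiableOn_eulerIntegral hb hcb).const_mul _, fun z hz => ?_⟩
    exact (ordinaryHypergeometric_eq_eulerIntegral a hb hcb (by simpa using hz)).symm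
  rw [hypF, dif_pos h]
  exact h.choose_spec

end

/-! ### Power series and the hypergeometric equation -/

noncomputable section

open Set

theorem hasFPowerSeriesOnBall_of_hasSum {u : ℕ → ℂ} {f : ℂ → ℂ}
    (h : ∀ z : ℂ, ‖z‖ < 1 → HasSum (fun n => u n * z ^ n) (f z)) :
    HasFPowerSeriesOnBall f (FormalMultilinearSeries.ofScalars ℂ u) 0 1 where
  r_le := by
    refine ENNReal.le_of_forall_nnreal_lt fun r hr => ?_
    have hr' : (r : ℝ) < 1 := by exact_mod_cast hr
    refine FormalMultilinearSeries.le_radius_of_summable_norm _ ?_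
    have := (h (r : ℝ) (by simpa using hr')).summable.norm
    refine this.congr fun n => ?_
    simp
  r_pos := one_pos
  hasSum := by
    intro y hy
    rw [zero_add]
    refine (h y (by simpa [enorm_eq_nnnorm, ← NNReal.coe_lt_one] using hy)).of_forall_eq fun n => ?_
    rw [FormalMultilinearSeries.ofScalars_apply_eq, smul_eq_mul]

theorem differentiableOn_of_hasSum {u : ℕ → ℂ} {f : ℂ → ℂ}
    (h : ∀ z : ℂ, ‖z‖ < 1 → HasSum (fun n => u n * z ^ n) (f z)) :
    DifferentiableOn ℂ f (Metric.ball 0 1) := by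
  have := (hasFPowerSeriesOnBall_of_hasSum h).differentiableOn
  rwa [← ENNReal.ofReal_one, Metric.eball_ofReal] at this

theorem hasSum_deriv_of_hasSum {u : ℕ → ℂ} {f : ℂ → ℂ}
    (h : ∀ z : ℂ, ‖z‖ < 1 → HasSum (fun n => u n * z ^ n) (f z)) {z : ℂ} (hz : ‖z‖ < 1) :
    HasSum (fun n : ℕ => ((n + 1) * u (n + 1)) * z ^ n) (deriv f z) := by
  have hp := hasFPowerSeriesOnBall_of_hasSum h
  have hu : u = fun n => iteratedDeriv n f 0 / n.factorial :=
    (FormalMultilinearSeries.ofScalars_series_eq_iff ℂ _ _).1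
      (hp.hasFPowerSeriesAt.eq_formalMultilinearSeries hp.analyticAt.hasFPowerSeriesAt)
  have hd : DifferentiableOn ℂ (deriv f) (Metric.ball 0 1) :=
    (differentiableOn_of_hasSum h).deriv Metric.isOpen_ball
  refine (Complex.hasSum_taylorSeries_on_ball hd (z := z) (by simpa using hz)).of_forall_eq
    fun n => ?_
  have h1 : ((n : ℂ) + 1) ≠ 0 := by exact_mod_cast n.succ_ne_zero
  have h2 : (n.factorial : ℂ) ≠ 0 := by exact_mod_cast n.factorial_ne_zero
  simp only [hu]
  rw [iteratedDeriv_succ', Nat.factorial_succ, smul_eq_mul, smul_eq_mul, sub_zero]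
  push_cast
  field_simp

theorem hasSum_mul_deriv_of_hasSum {u : ℕ → ℂ} {f : ℂ → ℂ}
    (h : ∀ z : ℂ, ‖z‖ < 1 → HasSum (fun n => u n * z ^ n) (f z)) {z : ℂ} (hz : ‖z‖ < 1) :
    HasSum (fun n : ℕ => (n * u n) * z ^ n) (z * deriv f z) := by
  have h1 := (hasSum_deriv_of_hasSum h hz).mul_left z
  rw [← hasSum_nat_add_iff' 1]
  simp only [Finset.range_one, Finset.sum_singleton, Nat.cast_zero, zero_mul, sub_zero]
  refine h1.of_forall_eq fun n => ?_
  push_cast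
  ring

theorem ofReal_add_natCast_ne_zero {c : ℝ} (hc : 0 < c) (n : ℕ) : (c : ℂ) + n ≠ 0 := by
  have : c + n ≠ 0 := by positivity
  exact_mod_cast this

theorem ordinaryHypergeometricCoefficient_succ (a b : ℂ) {c : ℝ} (hc : 0 < c) (n : ℕ) :
    ((c : ℂ) + n) * ((n + 1) * ordinaryHypergeometricCoefficient a b (c : ℂ) (n + 1)) =
      (a + n) * (b + n) * ordinaryHypergeometricCoefficient a b (c : ℂ) n := by
  have h1 : ((n : ℂ) + 1) ≠ 0 := by exact_mod_cast n.succ_ne_zero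
  have h2 : (n.factorial : ℂ) ≠ 0 := by exact_mod_cast n.factorial_ne_zero
  have h3 := ofReal_add_natCast_ne_zero hc n
  have h4 : (ascPochhammer ℂ n).eval (c : ℂ) ≠ 0 := by
    rw [Ne, ascPochhammer_eval_eq_zero_iff]
    rintro ⟨k, -, hk⟩
    exact ofReal_add_natCast_ne_zero hc k (by rw [hk]; ring)
  simp only [ordinaryHypergeometricCoefficient, ascPochhammer_succ_eval, Nat.factorial_succ]
  push_cast
  field_simp

/-- The sum of the hypergeometric series with real parameters, as a function on `ℂ`. -/
def gaussF (a b c : ℝ) (z : ℂ) : ℂ := ordinaryHypergeometric (a : ℂ) (b : ℂ) (c : ℂ) z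

theorem gaussF_zero (a b c : ℝ) : gaussF a b c 0 = 1 := ordinaryHypergeometric_zero _ _ _

theorem hasSum_gaussF {a b c : ℝ} (ha : 0 < a) (hb : 0 < b) (hc : 0 < c) {z : ℂ}
    (hz : ‖z‖ < 1) :
    HasSum (fun n => ordinaryHypergeometricCoefficient (a : ℂ) b c n * z ^ n)
      (gaussF a b c z) := by
  have hne {x : ℝ} (hx : 0 < x) (k : ℕ) : (k : ℂ) ≠ -x := fun h =>
    ofReal_add_natCast_ne_zero hx k (by rw [h]; ring)
  have hr := ordinaryHypergeometricSeries_radius_eq_one ℂ (a : ℂ) b c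
    fun k => ⟨hne ha k, hne hb k, hne hc k⟩
  have h := (ordinaryHypergeometricSeries ℂ (a : ℂ) b c).hasSum (x := z)
    (by rw [hr]; simpa [enorm_eq_nnnorm, ← NNReal.coe_lt_one] using hz)
  refine h.of_forall_eq fun n => ?_
  rw [ordinaryHypergeometricSeries_apply_eq, smul_eq_mul]

theorem differentiableOn_gaussF {a b c : ℝ} (ha : 0 < a) (hb : 0 < b)
    (hc : 0 < c) : DifferentiableOn ℂ (gaussF a b c) (Metric.ball 0 1) :=
  differentiableOn_of_hasSum fun _ hz => hasSum_gaussF ha hb hc hz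

/-- The hypergeometric differential equation. -/
theorem gaussF_ode {a b c : ℝ} (ha : 0 < a) (hb : 0 < b) (hc : 0 < c) {z : ℂ}
    (hz : ‖z‖ < 1) :
    z * (1 - z) * deriv (deriv (gaussF a b c)) z +
      (c - (a + b + 1) * z) * deriv (gaussF a b c) z -
      a * b * gaussF a b c z = 0 := by
  set f := gaussF a b c with hf
  set u := ordinaryHypergeometricCoefficient (a : ℂ) b (c : ℂ) with hu
  have h0 : ∀ z : ℂ, ‖z‖ < 1 → HasSum (fun n => u n * z ^ n) (f z) :=
    fun _ hz => hasSum_gaussF ha hb hc hz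
  have h1 := hasSum_deriv_of_hasSum h0 hz
  have hθ := hasSum_mul_deriv_of_hasSum h0 hz
  have hθd := hasSum_mul_deriv_of_hasSum (fun z hz => hasSum_deriv_of_hasSum h0 (z := z) hz) hz
  have hθθ := hasSum_mul_deriv_of_hasSum (fun z hz => hasSum_mul_deriv_of_hasSum h0 (z := z) hz) hz
  have hd : DifferentiableAt ℂ (deriv f) z :=
    ((differentiableOn_of_hasSum h0).deriv Metric.isOpen_ball).differentiableAt
      (Metric.isOpen_ball.mem_nhds (by simpa using hz))
  have hprod : deriv (fun w => w * deriv f w) z = deriv f z + z * deriv (deriv f) z := by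
    have := ((hasDerivAt_id' z).mul hd.hasDerivAt).deriv
    rw [one_mul] at this
    exact this
  rw [hprod] at hθθ
  -- With θ = z d/dz, the equation is z f'' + c f' = (θ² + (a + b) θ + ab) f; comparing coefficients
  -- of z^n gives the two-term recursion.
  have hsum := (((hθd.add (h1.mul_left (c : ℂ))).sub hθθ).sub (hθ.mul_left ((a : ℂ) + b))).sub
    ((h0 z hz).mul_left ((a : ℂ) * b))
  have hzero := hsum.unique (hasSum_zero.of_forall_eq fun n => by
    have := ordinaryHypergeometricCoefficient_succ (a : ℂ) b hc n
    rw [← hu] at this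
    linear_combination z ^ n * this)
  linear_combination hzero

/-! ### Wronskians and the connection formula -/

/-- `w`, with derivative `w'`, solves the hypergeometric equation on `U`. -/
def SolvesHypergeometric (a b c : ℂ) (U : Set ℂ) (w w' : ℂ → ℂ) : Prop :=
  ∀ z ∈ U, HasDerivAt w (w' z) z ∧ ∃ w'' : ℂ, HasDerivAt w' w'' z ∧
    z * (1 - z) * w'' + (c - (a + b + 1) * z) * w' z - a * b * w z = 0

/-- The intersection of the two discs on which the expansions at `0` and at `1` converge. -/
def hypLens : Set ℂ := Metric.ball 0 1 ∩ Metric.ball 1 1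

theorem isOpen_hypLens : IsOpen hypLens := Metric.isOpen_ball.inter Metric.isOpen_ball

theorem norm_lt_one_of_mem_hypLens {z : ℂ} (hz : z ∈ hypLens) : ‖z‖ < 1 := by
  simpa using hz.1

theorem norm_one_sub_lt_one_of_mem_hypLens {z : ℂ} (hz : z ∈ hypLens) : ‖1 - z‖ < 1 := by
  have := hz.2
  rwa [Metric.mem_ball, dist_comm, dist_eq_norm] at this

theorem one_sub_mem_slitPlane_of_mem_hypLens {z : ℂ} (hz : z ∈ hypLens) :
    1 - z ∈ Complex.slitPlane := by
  have := Complex.mem_slitPlane_of_norm_lt_one (z := -z)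
    (by simpa using norm_lt_one_of_mem_hypLens hz)
  rwa [← sub_eq_add_neg] at this

theorem mem_slitPlane_of_mem_hypLens {z : ℂ} (hz : z ∈ hypLens) : z ∈ Complex.slitPlane := by
  have := Complex.mem_slitPlane_of_norm_lt_one (z := z - 1)
    (by rw [norm_sub_rev]; exact norm_one_sub_lt_one_of_mem_hypLens hz)
  rwa [add_sub_cancel] at this

theorem ofReal_mem_hypLens {x : ℝ} (hx : x ∈ Ioo (0 : ℝ) 1) : (x : ℂ) ∈ hypLens := by
  constructor
  · rw [mem_ball_zero_iff, Complex.norm_real, Real.norm_of_nonneg hx.1.le]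
    exact hx.2
  · rw [Metric.mem_ball, dist_eq_norm, ← Complex.ofReal_one, ← Complex.ofReal_sub,
      Complex.norm_real, Real.norm_eq_abs, abs_lt]
    constructor <;> linarith [hx.1, hx.2]

/-- Abel's identity for the hypergeometric equation. -/
theorem SolvesHypergeometric.wronskian_const {a b c : ℂ} {w₁ w₁' w₂ w₂' : ℂ → ℂ}
    (h₁ : SolvesHypergeometric a b c hypLens w₁ w₁')
    (h₂ : SolvesHypergeometric a b c hypLens w₂ w₂') :
    ∃ C : ℂ, ∀ z ∈ hypLens,
      z ^ c * (1 - z) ^ (a + b + 1 - c) * (w₁ z * w₂' z - w₁' z * w₂ z) = C := by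
  have hconn : IsPreconnected hypLens :=
    ((convex_ball (0 : ℂ) 1).inter (convex_ball (1 : ℂ) 1)).isPreconnected
  -- The weight is the integrating factor: its logarithmic derivative is (c - (a + b + 1) z) / (z (1
  -- - z)), the coefficient of w' in the normalised equation.
  have hderiv : ∀ z ∈ hypLens, HasDerivAt (fun z =>
      z ^ c * (1 - z) ^ (a + b + 1 - c) * (w₁ z * w₂' z - w₁' z * w₂ z)) 0 z := by
    intro z hz
    obtain ⟨d₁, e₁, d₁', o₁⟩ := h₁ z hz
    obtain ⟨d₂, e₂, d₂', o₂⟩ := h₂ z hz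
    have hs := mem_slitPlane_of_mem_hypLens hz
    have hs' := one_sub_mem_slitPlane_of_mem_hypLens hz
    have h0 := Complex.slitPlane_ne_zero hs
    have h0' := Complex.slitPlane_ne_zero hs'
    have p₁ := (hasDerivAt_id z).cpow_const (c := c) hs
    have p₂ := ((hasDerivAt_id z).const_sub 1).cpow_const (c := a + b + 1 - c) hs'
    have := (p₁.mul p₂).mul ((d₁.mul d₂').sub (d₁'.mul d₂))
    refine this.congr_deriv ?_
    have q₁ : z ^ (c - 1) = z ^ c / z := by rw [Complex.cpow_sub _ _ h0, Complex.cpow_one]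
    have q₂ : (1 - z) ^ (a + b + 1 - c - 1) = (1 - z) ^ (a + b + 1 - c) / (1 - z) := by
      rw [Complex.cpow_sub _ _ h0', Complex.cpow_one]
    simp only [id, q₁, q₂, Pi.mul_apply, Pi.sub_apply]
    generalize z ^ c = P, (1 - z) ^ (a + b + 1 - c) = Q
    field_simp
    linear_combination P * Q * ((w₁ z) * o₂ - (w₂ z) * o₁)
  obtain ⟨C, hC⟩ := isOpen_hypLens.exists_is_const_of_deriv_eq_zero hconn
    (fun z hz => (hderiv z hz).differentiableAt.differentiableWithinAt)
    (fun z hz => (hderiv z hz).deriv)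
  exact ⟨C, hC⟩

theorem hasDerivAt_gaussF {a b c : ℝ} (ha : 0 < a) (hb : 0 < b) (hc : 0 < c) {z : ℂ}
    (hz : ‖z‖ < 1) : HasDerivAt (gaussF a b c) (deriv (gaussF a b c) z) z :=
  ((differentiableOn_gaussF ha hb hc).differentiableAt
    (Metric.isOpen_ball.mem_nhds (by simpa using hz))).hasDerivAt

theorem hasDerivAt_deriv_gaussF {a b c : ℝ} (ha : 0 < a) (hb : 0 < b) (hc : 0 < c) {z : ℂ}
    (hz : ‖z‖ < 1) : HasDerivAt (deriv (gaussF a b c)) (deriv (deriv (gaussF a b c)) z) z :=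
  (((differentiableOn_gaussF ha hb hc).deriv Metric.isOpen_ball).differentiableAt
    (Metric.isOpen_ball.mem_nhds (by simpa using hz))).hasDerivAt

theorem solvesHypergeometric_gaussF {a b c : ℝ} (ha : 0 < a) (hb : 0 < b) (hc : 0 < c) :
    SolvesHypergeometric a b c hypLens (gaussF a b c) (deriv (gaussF a b c)) := fun _ hz =>
  have hz' := norm_lt_one_of_mem_hypLens hz
  ⟨hasDerivAt_gaussF ha hb hc hz', _, hasDerivAt_deriv_gaussF ha hb hc hz',
    gaussF_ode ha hb hc hz'⟩

/-- The substitution z ↦ 1 - z preserves the equation and exchanges c with a + b - c + 1. -/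
theorem solvesHypergeometric_gaussF_one_sub {a b c : ℝ} (ha : 0 < a) (hb : 0 < b)
    (hc : 0 < a + b - c + 1) :
    SolvesHypergeometric a b c hypLens (fun z => gaussF a b (a + b - c + 1) (1 - z))
      (fun z => -deriv (gaussF a b (a + b - c + 1)) (1 - z)) := by
  intro z hz
  have hz' := norm_one_sub_lt_one_of_mem_hypLens hz
  have hs : HasDerivAt (fun z : ℂ => 1 - z) (-1) z := by
    simpa using (hasDerivAt_id z).const_sub 1
  refine ⟨?_, deriv (deriv (gaussF a b (a + b - c + 1))) (1 - z), ?_, ?_⟩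
  · exact ((hasDerivAt_gaussF ha hb hc hz').comp z hs).congr_deriv (by ring)
  · exact ((hasDerivAt_deriv_gaussF ha hb hc hz').comp z hs).neg.congr_deriv (by ring)
  · have := gaussF_ode ha hb hc hz'
    push_cast at this
    linear_combination this

/-- The second Frobenius solution `z ^ (1 - c) * F(a - c + 1, b - c + 1; 2 - c; z)` at `0`. -/
theorem solvesHypergeometric_cpow_mul_gaussF {a b c : ℝ} (ha : 0 < a - c + 1) (hb : 0 < b - c + 1)
    (hc : 0 < 2 - c) :
    SolvesHypergeometric a b c hypLens
      (fun z => z ^ (1 - c : ℂ) * gaussF (a - c + 1) (b - c + 1) (2 - c) z)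
      (fun z => (1 - c) * z ^ (-c : ℂ) * gaussF (a - c + 1) (b - c + 1) (2 - c) z +
        z ^ (1 - c : ℂ) * deriv (gaussF (a - c + 1) (b - c + 1) (2 - c)) z) := by
  intro z hz
  have hz' := norm_lt_one_of_mem_hypLens hz
  have hs := mem_slitPlane_of_mem_hypLens hz
  have h0 := Complex.slitPlane_ne_zero hs
  have d := hasDerivAt_gaussF ha hb hc hz'
  have d' := hasDerivAt_deriv_gaussF ha hb hc hz'
  have o := gaussF_ode ha hb hc hz'
  have p₁ : HasDerivAt (fun z : ℂ => z ^ (1 - c : ℂ)) ((1 - c) * z ^ (-c : ℂ)) z := by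
    have := (hasDerivAt_id' z).cpow_const (c := (1 - c : ℂ)) hs
    rwa [mul_one, show (1 - c - 1 : ℂ) = -c by ring] at this
  have p₂ : HasDerivAt (fun z : ℂ => z ^ (-c : ℂ)) (-c * z ^ (-c - 1 : ℂ)) z := by
    have := (hasDerivAt_id' z).cpow_const (c := (-c : ℂ)) hs
    rwa [mul_one] at this
  refine ⟨p₁.mul d, _, ((p₂.const_mul (1 - c : ℂ)).mul d).add (p₁.mul d'), ?_⟩
  have q₁ : z ^ (-c : ℂ) = z ^ (-c - 1 : ℂ) * z := by
    rw [Complex.cpow_sub _ _ h0, Complex.cpow_one, div_mul_cancel₀ _ h0]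
  have q₂ : z ^ (1 - c : ℂ) = z ^ (-c - 1 : ℂ) * z * z := by
    rw [← q₁, show (1 - c : ℂ) = -c + 1 by ring, Complex.cpow_add _ _ h0, Complex.cpow_one]
  simp only [q₁, q₂]
  push_cast at o
  linear_combination z ^ (-c - 1 : ℂ) * z ^ 2 * o

/-- For any three functions, w₁ W₂₃ + w₂ W₃₁ + w₃ W₁₂ = 0, where the W are their Wronskians. For
solutions these are constants over a common weight, so w₃ is a constant combination of w₁ and w₂
once W₁₂ is known not to vanish. -/
theorem exists_gaussF_connection {a b c : ℝ} (ha : 0 < a) (hb : 0 < b) (hc : 0 < c) (hc' : c < 1) :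
    ∃ A B : ℂ, ∀ z ∈ hypLens, gaussF a b (a + b - c + 1) (1 - z) =
      A * gaussF a b c z + B * (z ^ (1 - c : ℂ) * gaussF (a - c + 1) (b - c + 1) (2 - c) z) := by
  have pa : 0 < a - c + 1 := by linarith
  have pb : 0 < b - c + 1 := by linarith
  have pc : 0 < 2 - c := by linarith
  have s₁ := solvesHypergeometric_gaussF ha hb hc
  have s₂ := solvesHypergeometric_cpow_mul_gaussF pa pb pc
  have s₃ := solvesHypergeometric_gaussF_one_sub ha hb (show 0 < a + b - c + 1 by linarith)
  obtain ⟨C₁₂, h₁₂⟩ := s₁.wronskian_const s₂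
  obtain ⟨C₂₃, h₂₃⟩ := s₂.wronskian_const s₃
  obtain ⟨C₃₁, h₃₁⟩ := s₃.wronskian_const s₁
  set f := gaussF a b c with hf
  set g := gaussF (a - c + 1) (b - c + 1) (2 - c) with hg
  have hne : (1 - c : ℂ) ≠ 0 := by
    rw [← Complex.ofReal_one, ← Complex.ofReal_sub, Complex.ofReal_ne_zero]
    linarith
  -- The constant is read off as z tends to 0 inside the lens: absorbing z^c into the powers z^(-c)
  -- and z^(1-c) leaves an expression continuous at 0.
  have hC : C₁₂ = 1 - c := by
    have h0 : (0 : ℂ) ∈ Metric.ball (0 : ℂ) 1 := by simp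
    have cf : ContinuousAt f 0 := (hasDerivAt_gaussF ha hb hc (by simp)).continuousAt
    have cg : ContinuousAt g 0 := (hasDerivAt_gaussF pa pb pc (by simp)).continuousAt
    have cf' : ContinuousAt (deriv f) 0 := (hasDerivAt_deriv_gaussF ha hb hc (by simp)).continuousAt
    have cg' : ContinuousAt (deriv g) 0 := (hasDerivAt_deriv_gaussF pa pb pc (by simp)).continuousAt
    have cont : ContinuousAt (fun z : ℂ => (1 - z) ^ ((a : ℂ) + b + 1 - c) *
        ((1 - c) * f z * g z + z * (f z * deriv g z - deriv f z * g z))) 0 := by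
      have : ContinuousAt (fun z : ℂ => (1 - z) ^ ((a : ℂ) + b + 1 - c)) 0 :=
        ContinuousAt.cpow (by fun_prop) continuousAt_const (by simp)
      fun_prop
    have hlim := cont.tendsto.mono_left (nhdsWithin_le_nhds (s := hypLens))
    have hcl : (0 : ℂ) ∈ closure hypLens := by
      have h1 : Tendsto (fun x : ℝ => (x : ℂ)) (𝓝[>] 0) (𝓝 0) :=
        (Complex.continuous_ofReal.tendsto' 0 0 (by simp)).mono_left nhdsWithin_le_nhds
      refine mem_closure_of_tendsto h1 ?_
      filter_upwards [Ioo_mem_nhdsGT (zero_lt_one (α := ℝ))] with x hx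
      exact ofReal_mem_hypLens hx
    have : (𝓝[hypLens] (0 : ℂ)).NeBot := mem_closure_iff_nhdsWithin_neBot.1 hcl
    have hconst : Tendsto (fun z : ℂ => (1 - z) ^ ((a : ℂ) + b + 1 - c) *
        ((1 - c) * f z * g z + z * (f z * deriv g z - deriv f z * g z))) (𝓝[hypLens] 0) (𝓝 C₁₂) := by
      refine tendsto_const_nhds.congr' ?_
      filter_upwards [self_mem_nhdsWithin] with z hz
      have hz0 := Complex.slitPlane_ne_zero (mem_slitPlane_of_mem_hypLens hz)
      have e₁ : z ^ (c : ℂ) * z ^ (-c : ℂ) = 1 := by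
        rw [← Complex.cpow_add _ _ hz0, add_neg_cancel, Complex.cpow_zero]
      have e₂ : z ^ (c : ℂ) * z ^ (1 - c : ℂ) = z := by
        rw [← Complex.cpow_add _ _ hz0, add_sub_cancel, Complex.cpow_one]
      rw [← h₁₂ z hz]
      linear_combination (1 - z) ^ ((a : ℂ) + b + 1 - c) * ((1 - c) * f z * g z * e₁ +
        (f z * deriv g z - deriv f z * g z) * e₂)
    have := tendsto_nhds_unique hconst hlim
    simpa [hf, hg, gaussF_zero] using this
  refine ⟨-C₂₃ / (1 - c), -C₃₁ / (1 - c), fun z hz => ?_⟩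
  have e₁ := h₁₂ z hz
  have e₂ := h₂₃ z hz
  have e₃ := h₃₁ z hz
  rw [hC] at e₁
  have key : gaussF a b (a + b - c + 1) (1 - z) * (1 - c) =
      -C₂₃ * f z - C₃₁ * (z ^ (1 - c : ℂ) * g z) := by
    linear_combination -gaussF a b (a + b - c + 1) (1 - z) * e₁ - f z * e₂ -
      z ^ (1 - c : ℂ) * g z * e₃
  rw [eq_div_of_mul_eq hne key]
  ring

theorem sin_mul_sin_sub_sin_mul_sin (x y t : ℝ) :
    Real.sin (t - x) * Real.sin (t - y) - Real.sin x * Real.sin y =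
      Real.sin t * Real.sin (t - x - y) := by
  simp only [Real.sin_sub, Real.cos_sub]
  linear_combination (Real.sin x * Real.sin y) * Real.sin_sq_add_cos_sq t

/-- This is the connection formula evaluated at z = 1. Reflection turns the Gamma factors into
sines, and `sin_mul_sin_sub_sin_mul_sin` finishes. It serves twice: to determine the second
connection coefficient and to prove K₁ K₂ < 1. -/
theorem gamma_reflection_identity {a b c : ℝ} (ha : 0 < a) (hb : 0 < b) (hab : a + b < c)
    (hc' : c < 1) :
    Real.Gamma (a + b - c + 1) * Real.Gamma (1 - c) /
        (Real.Gamma (b - c + 1) * Real.Gamma (a - c + 1)) *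
        (Real.Gamma c * Real.Gamma (c - a - b) / (Real.Gamma (c - a) * Real.Gamma (c - b))) +
      -(Real.Gamma (a + b - c + 1) * Real.Gamma c / ((1 - c) * (Real.Gamma a * Real.Gamma b))) *
        (Real.Gamma (2 - c) * Real.Gamma (c - a - b) / (Real.Gamma (1 - a) * Real.Gamma (1 - b))) =
      1 := by
  have refl (x : ℝ) (h0 : 0 < x) (h1 : x < 1) :
      Real.Gamma (1 - x) = Real.pi / Real.sin (Real.pi * x) / Real.Gamma x ∧
        Real.sin (Real.pi * x) ≠ 0 ∧ Real.Gamma x ≠ 0 := by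
    have hG := (Real.Gamma_pos_of_pos h0).ne'
    refine ⟨?_, (Real.sin_pos_of_pos_of_lt_pi (by positivity)
      (by nlinarith [Real.pi_pos])).ne', hG⟩
    rw [← Real.Gamma_mul_Gamma_one_sub, mul_div_cancel_left₀ _ hG]
  obtain ⟨ra, sa, ga⟩ := refl a ha (by linarith)
  obtain ⟨rb, sb, gb⟩ := refl b hb (by linarith)
  obtain ⟨rc, sc, gc⟩ := refl c (by linarith) hc'
  obtain ⟨rd, sd, gd⟩ := refl (c - a - b) (by linarith) (by linarith)
  obtain ⟨re, se, ge⟩ := refl (c - a) (by linarith) (by linarith)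
  obtain ⟨rf, sf, gf⟩ := refl (c - b) (by linarith) (by linarith)
  have h2 : Real.Gamma (2 - c) = (1 - c) * Real.Gamma (1 - c) := by
    rw [← Real.Gamma_add_one (by linarith)]; ring_nf
  have hc1 : 1 - c ≠ 0 := by linarith
  rw [h2, show a + b - c + 1 = 1 - (c - a - b) by ring, show b - c + 1 = 1 - (c - b) by ring,
    show a - c + 1 = 1 - (c - a) by ring, ra, rb, rc, rd, re, rf]
  have trig := sin_mul_sin_sub_sin_mul_sin (Real.pi * a) (Real.pi * b) (Real.pi * c)
  rw [← mul_sub, ← mul_sub, ← mul_sub] at trig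
  have hpi := Real.pi_ne_zero
  field_simp
  linear_combination trig

/-- The connection formula between the local solutions at `1` and at `0`. -/
theorem gaussF_connection {a b c : ℝ} (ha : 0 < a) (hb : 0 < b) (hab : a + b < c) (hc' : c < 1)
    {z : ℂ} (hz : z ∈ hypLens) :
    gaussF a b (a + b - c + 1) (1 - z) =
      (Real.Gamma (a + b - c + 1) * Real.Gamma (1 - c) /
        (Real.Gamma (b - c + 1) * Real.Gamma (a - c + 1)) : ℝ) * gaussF a b c z +
      (-(Real.Gamma (a + b - c + 1) * Real.Gamma c / ((1 - c) * (Real.Gamma a * Real.Gamma b))) : ℝ) *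
        (z ^ (1 - c : ℂ) * gaussF (a - c + 1) (b - c + 1) (2 - c) z) := by
  have hc : 0 < c := by linarith
  have pa : 0 < a - c + 1 := by linarith
  have pb : 0 < b - c + 1 := by linarith
  have pc : 0 < 2 - c := by linarith
  have pd : 0 < a + b - c + 1 := by linarith
  obtain ⟨A, B, hAB⟩ := exists_gaussF_connection ha hb hc hc'
  have hsub0 : Tendsto (fun x : ℝ => 1 - x) (𝓝[>] 0) (𝓝[<] 1) := by
    refine tendsto_nhdsWithin_iff.2 ⟨?_, ?_⟩
    · exact (Continuous.tendsto' (by fun_prop) 0 1 (by simp)).mono_left nhdsWithin_le_nhds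
    · filter_upwards [self_mem_nhdsWithin] with x hx
      simpa using hx
  -- As z tends to 0 from the right, z^(1-c) kills the second solution, and Gauss's theorem
  -- evaluates the left side.
  have hA : A = (Real.Gamma (a + b - c + 1) * Real.Gamma (1 - c) /
      (Real.Gamma (b - c + 1) * Real.Gamma (a - c + 1)) : ℝ) := by
    have l₁ := (tendsto_ordinaryHypergeometric_one ha.le hb
      (show a + b < a + b - c + 1 by linarith)).comp hsub0
    have hre : Tendsto (fun x : ℝ => (x : ℂ)) (𝓝[>] 0) (𝓝 0) :=
      (Complex.continuous_ofReal.tendsto' 0 0 (by simp)).mono_left nhdsWithin_le_nhds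
    have l₂ : Tendsto (fun x : ℝ => A * gaussF a b c (x : ℂ) +
        B * (((x ^ (1 - c) : ℝ) : ℂ) * gaussF (a - c + 1) (b - c + 1) (2 - c) (x : ℂ)))
        (𝓝[>] 0) (𝓝 (A * 1 + B * (((0 : ℝ) : ℂ) * 1))) := by
      have t₁ : Tendsto (fun x : ℝ => gaussF a b c (x : ℂ)) (𝓝[>] 0) (𝓝 1) := by
        rw [← gaussF_zero a b c]
        exact (hasDerivAt_gaussF ha hb hc (by simp)).continuousAt.tendsto.comp hre
      have t₂ : Tendsto (fun x : ℝ => gaussF (a - c + 1) (b - c + 1) (2 - c) (x : ℂ)) (𝓝[>] 0)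
          (𝓝 1) := by
        rw [← gaussF_zero (a - c + 1) (b - c + 1) (2 - c)]
        exact (hasDerivAt_gaussF pa pb pc (by simp)).continuousAt.tendsto.comp hre
      have t₃ : Tendsto (fun x : ℝ => x ^ (1 - c)) (𝓝[>] 0) (𝓝 0) := by
        have := (Real.continuousAt_rpow_const 0 (1 - c) (Or.inr (by linarith))).tendsto
        rw [Real.zero_rpow (by linarith)] at this
        exact this.mono_left nhdsWithin_le_nhds
      exact (t₁.const_mul A).add
        ((((Complex.continuous_ofReal.tendsto 0).comp t₃).mul t₂).const_mul B)
    have := tendsto_nhds_unique (l₂.congr' ?_) l₁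
    · rw [Complex.ofReal_zero, mul_one, zero_mul, mul_zero, add_zero] at this
      rw [this, show a + b - c + 1 - a - b = 1 - c by ring,
        show a + b - c + 1 - a = b - c + 1 by ring, show a + b - c + 1 - b = a - c + 1 by ring]
    · filter_upwards [Ioo_mem_nhdsGT (zero_lt_one (α := ℝ))] with x hx
      rw [Complex.ofReal_cpow hx.1.le, Complex.ofReal_sub, Complex.ofReal_one,
        ← hAB x (ofReal_mem_hypLens hx)]
      simp [gaussF]
  -- As z tends to 1 from the left, the left side tends to 1 and both solutions on the right
  -- converge by Gauss's theorem; `gamma_reflection_identity` solves the resulting linear equation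
  -- for B.
  have hB : B = (-(Real.Gamma (a + b - c + 1) * Real.Gamma c /
      ((1 - c) * (Real.Gamma a * Real.Gamma b))) : ℝ) := by
    have l₁ := tendsto_ordinaryHypergeometric_one ha.le hb hab
    have l₂ := tendsto_ordinaryHypergeometric_one pa.le pb
      (show a - c + 1 + (b - c + 1) < 2 - c by linarith)
    have hre : Tendsto (fun x : ℝ => (1 : ℂ) - x) (𝓝[<] 1) (𝓝 0) :=
      (Continuous.tendsto' (by fun_prop) 1 0 (by simp)).mono_left nhdsWithin_le_nhds
    have t₀ : Tendsto (fun x : ℝ => gaussF a b (a + b - c + 1) (1 - x : ℂ)) (𝓝[<] 1) (𝓝 1) := by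
      have := (hasDerivAt_gaussF ha hb pd (z := 0) (by simp)).continuousAt.tendsto.comp hre
      rwa [gaussF_zero] at this
    have t₃ : Tendsto (fun x : ℝ => (((x ^ (1 - c) : ℝ)) : ℂ)) (𝓝[<] 1) (𝓝 1) := by
      have := (Real.continuousAt_rpow_const 1 (1 - c) (Or.inl one_ne_zero)).tendsto
      rw [Real.one_rpow] at this
      exact (Complex.continuous_ofReal.tendsto' 1 1 (by simp)).comp
        (this.mono_left nhdsWithin_le_nhds)
    have l := (l₁.const_mul A).add ((t₃.mul l₂).const_mul B)
    have key := tendsto_nhds_unique (t₀.congr' ?_) l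
    · have id₁ := gamma_reflection_identity ha hb hab hc'
      rw [show 2 - c - (a - c + 1) - (b - c + 1) = c - a - b by ring,
        show 2 - c - (a - c + 1) = 1 - a by ring, show 2 - c - (b - c + 1) = 1 - b by ring,
        one_mul, hA] at key
      have hne : Real.Gamma (2 - c) * Real.Gamma (c - a - b) /
          (Real.Gamma (1 - a) * Real.Gamma (1 - b)) ≠ 0 := by
        have h₁ := Real.Gamma_pos_of_pos pc
        have h₂ := Real.Gamma_pos_of_pos (show 0 < c - a - b by linarith)
        have h₃ := Real.Gamma_pos_of_pos (show 0 < 1 - a by linarith)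
        have h₄ := Real.Gamma_pos_of_pos (show 0 < 1 - b by linarith)
        positivity
      have id₂ := congrArg (fun x : ℝ => (x : ℂ)) id₁
      simp only [Complex.ofReal_add, Complex.ofReal_mul (_ / _), Complex.ofReal_mul (-_),
        Complex.ofReal_one] at id₂
      rw [key] at id₂
      exact (mul_right_cancel₀ (Complex.ofReal_ne_zero.2 hne) (add_left_cancel id₂)).symm
    · filter_upwards [Ioo_mem_nhdsLT (zero_lt_one (α := ℝ))] with x hx
      rw [Complex.ofReal_cpow hx.1.le, Complex.ofReal_sub, Complex.ofReal_one,
        hAB x (ofReal_mem_hypLens hx)]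
      simp [gaussF]
  rw [← hA, ← hB]
  exact hAB z hz

/-- The identity theorem carries the connection formula from the lens to the slit unit disc, which
is star-shaped about 1/2. The wider domain is needed to surround 0. -/
theorem hypF_one_sub_eq {a b c : ℝ} (ha : 0 < a) (hb : 0 < b) (hab : a + b < c) (hc' : c < 1)
    {z : ℂ} (hz : z ∈ Complex.slitPlane) (hz1 : ‖z‖ < 1) :
    hypF a b (a + b - c + 1 : ℂ) (1 - z) =
      (Real.Gamma (a + b - c + 1) * Real.Gamma (1 - c) /
        (Real.Gamma (b - c + 1) * Real.Gamma (a - c + 1)) : ℝ) * gaussF a b c z +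
      (-(Real.Gamma (a + b - c + 1) * Real.Gamma c / ((1 - c) * (Real.Gamma a * Real.Gamma b))) : ℝ) *
        (z ^ (1 - c : ℂ) * gaussF (a - c + 1) (b - c + 1) (2 - c) z) := by
  have spec := hypF_spec a hb (show b < a + b - c + 1 by linarith)
  push_cast at spec
  set U : Set ℂ := Complex.slitPlane ∩ Metric.ball 0 1 with hU
  have hUo : IsOpen U := Complex.isOpen_slitPlane.inter Metric.isOpen_ball
  have hhalf : (((1 / 2 : ℝ) : ℝ) : ℂ) ∈ hypLens := ofReal_mem_hypLens (by norm_num)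
  have hsub : hypLens ⊆ U := fun w hw => ⟨mem_slitPlane_of_mem_hypLens hw, hw.1⟩
  have hUc : IsPreconnected U := by
    have h1 : StarConvex ℝ (((1 / 2 : ℝ) : ℝ) : ℂ) U :=
      (Complex.starConvex_ofReal_slitPlane (by norm_num)).inter
        ((convex_ball (0 : ℂ) 1).starConvex hhalf.1)
    exact (h1.isPathConnected (hsub hhalf)).isConnected.isPreconnected
  have hL : AnalyticOnNhd ℂ (fun z => hypF a b (a + b - c + 1 : ℂ) (1 - z)) U := by
    refine DifferentiableOn.analyticOnNhd ?_ hUo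
    refine spec.1.comp (f := fun z : ℂ => 1 - z) (by fun_prop) fun w hw => ?_
    simpa using hw.1
  have hR : AnalyticOnNhd ℂ (fun z => (Real.Gamma (a + b - c + 1) * Real.Gamma (1 - c) /
        (Real.Gamma (b - c + 1) * Real.Gamma (a - c + 1)) : ℝ) * gaussF a b c z +
      (-(Real.Gamma (a + b - c + 1) * Real.Gamma c / ((1 - c) * (Real.Gamma a * Real.Gamma b))) : ℝ) *
        (z ^ (1 - c : ℂ) * gaussF (a - c + 1) (b - c + 1) (2 - c) z)) U := by
    refine DifferentiableOn.analyticOnNhd (fun w hw => ?_) hUo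
    have hw1 : ‖w‖ < 1 := by simpa using hw.2
    have d₁ := hasDerivAt_gaussF ha hb (show 0 < c by linarith) hw1
    have d₂ := hasDerivAt_gaussF (show 0 < a - c + 1 by linarith) (show 0 < b - c + 1 by linarith)
      (show 0 < 2 - c by linarith) hw1
    have d₃ := (hasDerivAt_id' w).cpow_const (c := (1 - c : ℂ)) hw.1
    exact ((d₁.const_mul _).add ((d₃.mul d₂).const_mul _)).differentiableAt.differentiableWithinAt
  refine hL.eqOn_of_preconnected_of_eventuallyEq hR hUc (hsub hhalf) ?_ ⟨hz, by simpa using hz1⟩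
  filter_upwards [isOpen_hypLens.mem_nhds hhalf] with w hw
  rw [← gaussF_connection ha hb hab hc' hw,
    spec.2 (by simpa using norm_one_sub_lt_one_of_mem_hypLens hw), gaussF]
  push_cast
  rfl

end

/-! ### Wirtinger calculus and powers of |z| -/

noncomputable section

open ComplexConjugate

theorem dz_mul {f g : ℂ → ℂ} {z : ℂ} (hf : DifferentiableAt ℝ f z) (hg : DifferentiableAt ℝ g z) :
    dz (fun w => f w * g w) z = f z * dz g z + g z * dz f z := by
  simp only [dz, fderiv_fun_mul hf hg, add_apply, smul_apply, smul_eq_mul]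
  ring

theorem dzbar_mul {f g : ℂ → ℂ} {z : ℂ} (hf : DifferentiableAt ℝ f z)
    (hg : DifferentiableAt ℝ g z) :
    dzbar (fun w => f w * g w) z = f z * dzbar g z + g z * dzbar f z := by
  simp only [dzbar, fderiv_fun_mul hf hg, add_apply, smul_apply, smul_eq_mul]
  ring

theorem dz_sub {f g : ℂ → ℂ} {z : ℂ} (hf : DifferentiableAt ℝ f z) (hg : DifferentiableAt ℝ g z) :
    dz (fun w => f w - g w) z = dz f z - dz g z := by
  simp only [dz, fderiv_fun_sub hf hg, sub_apply]
  ring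

theorem dzbar_sub {f g : ℂ → ℂ} {z : ℂ} (hf : DifferentiableAt ℝ f z)
    (hg : DifferentiableAt ℝ g z) :
    dzbar (fun w => f w - g w) z = dzbar f z - dzbar g z := by
  simp only [dzbar, fderiv_fun_sub hf hg, sub_apply]
  ring

theorem fderiv_real_apply {f : ℂ → ℂ} {f' z : ℂ} (h : HasDerivAt f f' z) (w : ℂ) :
    fderiv ℝ f z w = f' * w := by
  rw [(h.hasFDerivAt.restrictScalars ℝ).fderiv]
  simp [mul_comm]

theorem dz_of_hasDerivAt {f : ℂ → ℂ} {f' z : ℂ} (h : HasDerivAt f f' z) : dz f z = f' := by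
  rw [dz, fderiv_real_apply h, fderiv_real_apply h]
  linear_combination (-f' / 2) * Complex.I_mul_I

theorem dzbar_of_hasDerivAt {f : ℂ → ℂ} {f' z : ℂ} (h : HasDerivAt f f' z) : dzbar f z = 0 := by
  rw [dzbar, fderiv_real_apply h, fderiv_real_apply h]
  linear_combination (f' / 2) * Complex.I_mul_I

theorem HasDerivAt.differentiableAt_real {f : ℂ → ℂ} {f' z : ℂ} (h : HasDerivAt f f' z) :
    DifferentiableAt ℝ f z := (h.hasFDerivAt.restrictScalars ℝ).differentiableAt

theorem fderiv_conj_comp {f : ℂ → ℂ} {z : ℂ} (w : ℂ) :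
    fderiv ℝ (fun y => conj (f y)) z w = conj (fderiv ℝ f z w) := by
  have h : fderiv ℝ (Complex.conjCLE ∘ f) z = _ := Complex.conjCLE.comp_fderiv
  have h' := DFunLike.congr_fun h w
  simpa [Function.comp_def] using h'

theorem dz_conj_comp (f : ℂ → ℂ) (z : ℂ) : dz (fun y => conj (f y)) z = conj (dzbar f z) := by
  simp [dz, dzbar, fderiv_conj_comp, sub_eq_add_neg, map_ofNat (starRingEnd ℂ) 2]

theorem dzbar_conj_comp (f : ℂ → ℂ) (z : ℂ) : dzbar (fun y => conj (f y)) z = conj (dz f z) := by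
  simp [dz, dzbar, fderiv_conj_comp, sub_eq_add_neg, map_ofNat (starRingEnd ℂ) 2]

theorem DifferentiableAt.conj_comp {f : ℂ → ℂ} {z : ℂ} (h : DifferentiableAt ℝ f z) :
    DifferentiableAt ℝ (fun y => conj (f y)) z :=
  Complex.conjCLE.differentiableAt.comp z h

/-- The punctured plane is open, so identities valid on a punctured neighbourhood may be
differentiated there. -/
theorem eventually_eventually_nhds_of_punctured {p : ℂ → Prop} {z₀ : ℂ}
    (h : ∀ᶠ z in 𝓝[≠] z₀, p z) : ∀ᶠ z in 𝓝[≠] z₀, ∀ᶠ w in 𝓝 z, p w := by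
  filter_upwards [eventually_eventually_nhdsWithin.2 h, self_mem_nhdsWithin] with z hz hz0
  rwa [isOpen_compl_singleton.nhdsWithin_eq hz0] at hz

theorem Filter.EventuallyEq.dz_dzbar {f g : ℂ → ℂ} {z₀ : ℂ} (h : f =ᶠ[𝓝[≠] z₀] g) :
    dz f =ᶠ[𝓝[≠] z₀] dz g ∧ dzbar f =ᶠ[𝓝[≠] z₀] dzbar g := by
  have h2 : ∀ᶠ z in 𝓝[≠] z₀, f =ᶠ[𝓝 z] g := eventually_eventually_nhds_of_punctured h
  exact ⟨h2.mono fun z hz => by simp [dz, hz.fderiv_eq],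
    h2.mono fun z hz => by simp [dzbar, hz.fderiv_eq]⟩

/-- The power `|z| ^ (2 s)`. -/
def normPow (s : ℝ) (z : ℂ) : ℝ := ‖z‖ ^ (2 * s)

theorem hasFDerivAt_normPow (s : ℝ) {z : ℂ} (hz : z ≠ 0) :
    HasFDerivAt (normPow s) ((s * (‖z‖ ^ 2) ^ (s - 1)) • (2 • innerSL ℝ z)) z := by
  have h := (hasStrictFDerivAt_norm_sq z).hasFDerivAt.rpow_const (p := s)
    (Or.inl (by positivity))
  refine h.congr_of_eventuallyEq (Eventually.of_forall fun w => ?_)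
  rw [normPow, Real.rpow_mul (norm_nonneg _), Real.rpow_two]

theorem fderiv_normPow_apply (s : ℝ) {z : ℂ} (hz : z ≠ 0) (w : ℂ) :
    ((fderiv ℝ (normPow s) z w : ℝ) : ℂ) =
      s * normPow s z * (w / z + conj w / conj z) := by
  rw [(hasFDerivAt_normPow s hz).fderiv]
  have hn : ‖z‖ ^ 2 ≠ 0 := by positivity
  have h1 : (‖z‖ ^ 2) ^ (s - 1) = normPow s z / ‖z‖ ^ 2 := by
    rw [Real.rpow_sub_one hn, normPow, Real.rpow_mul (norm_nonneg _), Real.rpow_two]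
  have hc : conj z ≠ 0 := by simpa using hz
  have h2 : ((‖z‖ ^ 2 : ℝ) : ℂ) = z * conj z := by
    rw [Complex.mul_conj, Complex.normSq_eq_norm_sq]
  have h3 : ((2 * inner ℝ z w : ℝ) : ℂ) = conj z * w + z * conj w := by
    apply Complex.ext <;> simp [Complex.inner] <;> ring
  have h4 : (((s * (‖z‖ ^ 2) ^ (s - 1)) • (2 • innerSL ℝ z)) w : ℝ) =
      s * normPow s z / ‖z‖ ^ 2 * (2 * inner ℝ z w) := by
    simp [h1]
    ring
  rw [h4, Complex.ofReal_mul, h3, Complex.ofReal_div, h2, Complex.ofReal_mul]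
  field_simp

theorem dz_ofReal_comp {τ : ℂ → ℝ} {z : ℂ} (h : DifferentiableAt ℝ τ z) :
    dz (fun w => (τ w : ℂ)) z =
      ((fderiv ℝ τ z 1 : ℝ) - Complex.I * (fderiv ℝ τ z Complex.I : ℝ)) / 2 := by
  have : HasFDerivAt (fun w => (τ w : ℂ)) (Complex.ofRealCLM.comp (fderiv ℝ τ z)) z :=
    Complex.ofRealCLM.hasFDerivAt.comp z h.hasFDerivAt
  rw [dz, this.fderiv]
  simp

theorem dzbar_ofReal_comp {τ : ℂ → ℝ} {z : ℂ} (h : DifferentiableAt ℝ τ z) :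
    dzbar (fun w => (τ w : ℂ)) z =
      ((fderiv ℝ τ z 1 : ℝ) + Complex.I * (fderiv ℝ τ z Complex.I : ℝ)) / 2 := by
  have : HasFDerivAt (fun w => (τ w : ℂ)) (Complex.ofRealCLM.comp (fderiv ℝ τ z)) z :=
    Complex.ofRealCLM.hasFDerivAt.comp z h.hasFDerivAt
  rw [dzbar, this.fderiv]
  simp

theorem DifferentiableAt.ofReal_comp_complex {τ : ℂ → ℝ} {z : ℂ} (h : DifferentiableAt ℝ τ z) :
    DifferentiableAt ℝ (fun w => (τ w : ℂ)) z :=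
  Complex.ofRealCLM.differentiableAt.comp z h

theorem dz_normPow (s : ℝ) {z : ℂ} (hz : z ≠ 0) :
    dz (fun w => (normPow s w : ℂ)) z = s * normPow s z / z := by
  rw [dz_ofReal_comp (hasFDerivAt_normPow s hz).differentiableAt, fderiv_normPow_apply s hz,
    fderiv_normPow_apply s hz]
  have hc : conj z ≠ 0 := by simpa using hz
  simp only [map_one, Complex.conj_I]
  field_simp
  linear_combination s * normPow s z * (z - conj z) * Complex.I_sq

theorem dzbar_normPow (s : ℝ) {z : ℂ} (hz : z ≠ 0) :
    dzbar (fun w => (normPow s w : ℂ)) z = s * normPow s z / conj z := by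
  rw [dzbar_ofReal_comp (hasFDerivAt_normPow s hz).differentiableAt, fderiv_normPow_apply s hz,
    fderiv_normPow_apply s hz]
  have hc : conj z ≠ 0 := by simpa using hz
  simp only [map_one, Complex.conj_I]
  field_simp
  linear_combination s * normPow s z * (conj z - z) * Complex.I_sq

theorem tendsto_normPow {s : ℝ} (hs : 0 < s) : Tendsto (normPow s) (𝓝[≠] 0) (𝓝 0) := by
  have h : ContinuousAt (normPow s) 0 :=
    (continuous_norm.continuousAt).rpow_const (Or.inr (by positivity))
  have h0 : normPow s 0 = 0 := by
    rw [normPow, norm_zero, Real.zero_rpow (by positivity)]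
  have := h.tendsto.mono_left (nhdsWithin_le_nhds (s := {0}ᶜ))
  rwa [h0] at this

theorem tendsto_prod_normPow {s : ℝ} (hs : 0 < s) :
    Tendsto (fun z : ℂ => (z, normPow s z)) (𝓝[≠] 0) (𝓝 (0 : ℂ × ℝ)) :=
  (tendsto_id.mono_left nhdsWithin_le_nhds).prodMk_nhds (tendsto_normPow hs)

theorem fderiv_comp_prod_normPow {Φ : ℂ × ℝ → ℂ} {s : ℝ} {z : ℂ} (hz : z ≠ 0)
    (hΦ : DifferentiableAt ℝ Φ (z, normPow s z)) :
    DifferentiableAt ℝ (fun w => Φ (w, normPow s w)) z ∧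
    ∀ w, fderiv ℝ (fun w => Φ (w, normPow s w)) z w = fderiv ℝ Φ (z, normPow s z) (w, 0) +
      (fderiv ℝ (normPow s) z w : ℝ) * fderiv ℝ Φ (z, normPow s z) (0, 1) := by
  have h := (hΦ.hasFDerivAt.comp z
    ((hasFDerivAt_id z).prodMk (hasFDerivAt_normPow s hz).differentiableAt.hasFDerivAt))
  refine ⟨h.differentiableAt, fun w => ?_⟩
  have h2 : fderiv ℝ (fun w => Φ (w, normPow s w)) z = _ := h.fderiv
  rw [h2]
  have h3 : (w, fderiv ℝ (normPow s) z w) =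
      ((w, 0) : ℂ × ℝ) + (fderiv ℝ (normPow s) z w) • ((0, 1) : ℂ × ℝ) := by simp
  simp only [ContinuousLinearMap.comp_apply, ContinuousLinearMap.prod_apply,
    ContinuousLinearMap.id_apply]
  rw [h3, map_add, map_smul, Complex.real_smul]

theorem dz_comp_prod_normPow {Φ : ℂ × ℝ → ℂ} {s : ℝ} {z : ℂ} (hz : z ≠ 0)
    (hΦ : DifferentiableAt ℝ Φ (z, normPow s z)) :
    dz (fun w => Φ (w, normPow s w)) z = (fderiv ℝ Φ (z, normPow s z) (1, 0) -
        Complex.I * fderiv ℝ Φ (z, normPow s z) (Complex.I, 0)) / 2 +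
      fderiv ℝ Φ (z, normPow s z) (0, 1) * (s * normPow s z / z) := by
  rw [← dz_normPow s hz, dz_ofReal_comp (hasFDerivAt_normPow s hz).differentiableAt, dz,
    (fderiv_comp_prod_normPow hz hΦ).2, (fderiv_comp_prod_normPow hz hΦ).2]
  ring

theorem dzbar_comp_prod_normPow {Φ : ℂ × ℝ → ℂ} {s : ℝ} {z : ℂ} (hz : z ≠ 0)
    (hΦ : DifferentiableAt ℝ Φ (z, normPow s z)) :
    dzbar (fun w => Φ (w, normPow s w)) z = (fderiv ℝ Φ (z, normPow s z) (1, 0) +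
        Complex.I * fderiv ℝ Φ (z, normPow s z) (Complex.I, 0)) / 2 +
      fderiv ℝ Φ (z, normPow s z) (0, 1) * (s * normPow s z / conj z) := by
  rw [← dzbar_normPow s hz, dzbar_ofReal_comp (hasFDerivAt_normPow s hz).differentiableAt, dzbar,
    (fderiv_comp_prod_normPow hz hΦ).2, (fderiv_comp_prod_normPow hz hΦ).2]
  ring

/-! ### Functions analytic in z and |z|^(2s) -/

/-- Near `0`, `F` has the form `z ^ (-n) * conj z ^ (-m) * |z| ^ (2 s) * Φ (z, |z| ^ (2 s))` with
`Φ` real-analytic at the origin and `Φ 0 = C`. -/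
def HasNormPowForm (s : ℝ) (n m : ℕ) (C : ℂ) (F : ℂ → ℂ) : Prop :=
  ∃ Φ : ℂ × ℝ → ℂ, AnalyticAt ℝ Φ 0 ∧ Φ 0 = C ∧ ∀ᶠ z in 𝓝[≠] (0 : ℂ),
    F z = (z ^ n)⁻¹ * conj (z ^ m)⁻¹ * normPow s z * Φ (z, normPow s z)

theorem hasDerivAt_pow_inv (n : ℕ) {z : ℂ} (hz : z ≠ 0) :
    HasDerivAt (fun w : ℂ => (w ^ n)⁻¹) (-n * (z ^ (n + 1))⁻¹) z := by
  have h := hasDerivAt_zpow (-n : ℤ) z (Or.inl hz)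
  have h1 : (fun w : ℂ => (w ^ n)⁻¹) = fun w : ℂ => w ^ (-n : ℤ) := by
    ext w; simp
  rw [h1]
  refine h.congr_deriv ?_
  rw [show (-(n : ℤ) - 1) = -((n + 1 : ℕ) : ℤ) by push_cast; ring, zpow_neg, zpow_natCast]
  push_cast
  ring

section NormPowForm

variable {s : ℝ} {n m : ℕ} {C : ℂ} {F : ℂ → ℂ}

theorem eventually_differentiableAt_comp_normPow (hs : 0 < s) {Φ : ℂ × ℝ → ℂ}
    (hΦ : AnalyticAt ℝ Φ 0) :
    ∀ᶠ z in 𝓝[≠] (0 : ℂ), DifferentiableAt ℝ Φ (z, normPow s z) :=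
  ((tendsto_prod_normPow hs).eventually hΦ.eventually_analyticAt).mono
    fun _ h => h.differentiableAt

/-- Since z ∂ sends |z|^(2s) to s |z|^(2s), the product and chain rules replace Φ by (s - n) Φ + z
∂Φ + s t ∂Φ/∂t. The last two terms vanish at the origin, so only the factor s - n reaches the
leading coefficient; ∂̄ behaves likewise with m. -/
theorem HasNormPowForm.dz_dzbar (hs : 0 < s) (h : HasNormPowForm s n m C F) :
    (∀ᶠ z in 𝓝[≠] (0 : ℂ), DifferentiableAt ℝ F z) ∧
    HasNormPowForm s (n + 1) m ((s - n) * C) (dz F) ∧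
    HasNormPowForm s n (m + 1) ((s - m) * C) (dzbar F) := by
  obtain ⟨Φ, hΦ, h0, hF⟩ := h
  have hfd (v : ℂ × ℝ) : AnalyticAt ℝ (fun p => fderiv ℝ Φ p v) 0 :=
    ((ContinuousLinearMap.apply ℝ ℂ v).analyticAt _).comp hΦ.fderiv
  have hfst : AnalyticAt ℝ (fun p : ℂ × ℝ => p.1) 0 := analyticAt_fst
  have hsnd : AnalyticAt ℝ (fun p : ℂ × ℝ => (p.2 : ℂ)) 0 :=
    (Complex.ofRealCLM.analyticAt _).comp analyticAt_snd
  have hconj : AnalyticAt ℝ (fun p : ℂ × ℝ => conj p.1) 0 :=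
    (Complex.conjCLE.toContinuousLinearMap.analyticAt _).comp analyticAt_fst
  have hdiff := eventually_differentiableAt_comp_normPow hs hΦ
  have hloc := eventually_eventually_nhds_of_punctured hF
  have hne : ∀ᶠ z in 𝓝[≠] (0 : ℂ), z ≠ 0 := self_mem_nhdsWithin
  have factors : ∀ z : ℂ, z ≠ 0 → DifferentiableAt ℝ Φ (z, normPow s z) →
      DifferentiableAt ℝ (fun w : ℂ => (w ^ n)⁻¹) z ∧
      DifferentiableAt ℝ (fun w : ℂ => conj (w ^ m)⁻¹) z ∧
      DifferentiableAt ℝ (fun w : ℂ => (normPow s w : ℂ)) z ∧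
      DifferentiableAt ℝ (fun w : ℂ => Φ (w, normPow s w)) z := fun z hz hd =>
    ⟨(hasDerivAt_pow_inv n hz).differentiableAt_real,
      (hasDerivAt_pow_inv m hz).differentiableAt_real.conj_comp,
      (hasFDerivAt_normPow s hz).differentiableAt.ofReal_comp_complex,
      (fderiv_comp_prod_normPow hz hd).1⟩
  refine ⟨?_, ⟨fun p => (s - n) * Φ p + p.1 * ((fderiv ℝ Φ p (1, 0) -
      Complex.I * fderiv ℝ Φ p (Complex.I, 0)) / 2) + s * p.2 * fderiv ℝ Φ p (0, 1), ?_, ?_, ?_⟩,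
    ⟨fun p => (s - m) * Φ p + conj p.1 * ((fderiv ℝ Φ p (1, 0) +
      Complex.I * fderiv ℝ Φ p (Complex.I, 0)) / 2) + s * p.2 * fderiv ℝ Φ p (0, 1), ?_, ?_, ?_⟩⟩
  · filter_upwards [hdiff, hloc, hne] with z hd hz hz0
    obtain ⟨d₁, d₂, d₃, d₄⟩ := factors z hz0 hd
    exact (((d₁.fun_mul d₂).fun_mul d₃).fun_mul d₄).congr_of_eventuallyEq hz
  · exact ((analyticAt_const.mul hΦ).add (hfst.mul
      (((hfd _).sub (analyticAt_const.mul (hfd _))).div analyticAt_const two_ne_zero))).add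
      ((analyticAt_const.mul hsnd).mul (hfd _))
  · simp [h0]
  · filter_upwards [hdiff, hloc, hne] with z hd hz hz0
    obtain ⟨d₁, d₂, d₃, d₄⟩ := factors z hz0 hd
    have e : dz F z = dz (fun z => (z ^ n)⁻¹ * conj (z ^ m)⁻¹ * normPow s z *
      Φ (z, normPow s z)) z := by simp only [dz, EventuallyEq.fderiv_eq hz]
    rw [e, dz_mul ((d₁.fun_mul d₂).fun_mul d₃) d₄, dz_mul (d₁.fun_mul d₂) d₃, dz_mul d₁ d₂,
      dz_of_hasDerivAt (hasDerivAt_pow_inv n hz0), dz_conj_comp,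
      dzbar_of_hasDerivAt (hasDerivAt_pow_inv m hz0), dz_normPow s hz0,
      dz_comp_prod_normPow hz0 hd, map_zero]
    field_simp
    ring
  · exact ((analyticAt_const.mul hΦ).add (hconj.mul
      (((hfd _).add (analyticAt_const.mul (hfd _))).div analyticAt_const two_ne_zero))).add
      ((analyticAt_const.mul hsnd).mul (hfd _))
  · simp [h0]
  · filter_upwards [hdiff, hloc, hne] with z hd hz hz0
    obtain ⟨d₁, d₂, d₃, d₄⟩ := factors z hz0 hd
    have hc0 : conj z ≠ 0 := by simpa using hz0
    have e : dzbar F z = dzbar (fun z => (z ^ n)⁻¹ * conj (z ^ m)⁻¹ * normPow s z *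
      Φ (z, normPow s z)) z := by simp only [dzbar, EventuallyEq.fderiv_eq hz]
    rw [e, dzbar_mul ((d₁.fun_mul d₂).fun_mul d₃) d₄, dzbar_mul (d₁.fun_mul d₂) d₃, dzbar_mul d₁ d₂,
      dzbar_of_hasDerivAt (hasDerivAt_pow_inv n hz0), dzbar_conj_comp,
      dz_of_hasDerivAt (hasDerivAt_pow_inv m hz0), dzbar_normPow s hz0,
      dzbar_comp_prod_normPow hz0 hd]
    simp only [map_mul, map_neg, map_natCast, map_inv₀, map_pow]
    field_simp
    ring

theorem HasNormPowForm.neg (h : HasNormPowForm s n m C F) :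
    HasNormPowForm s n m (-C) (fun z => -F z) := by
  obtain ⟨Φ, hΦ, h0, hF⟩ := h
  exact ⟨fun p => -Φ p, hΦ.neg, by simp [h0], hF.mono fun z hz => by simp only [hz]; ring⟩

theorem HasNormPowForm.congr {G : ℂ → ℂ} (h : HasNormPowForm s n m C F)
    (hFG : G =ᶠ[𝓝[≠] 0] F) : HasNormPowForm s n m C G := by
  obtain ⟨Φ, hΦ, h0, hF⟩ := h
  refine ⟨Φ, hΦ, h0, ?_⟩
  filter_upwards [hF, hFG] with z hz hz'
  rw [hz', hz]

theorem HasNormPowForm.tendsto (hs : 0 < s) (h : HasNormPowForm s n m C F) :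
    Tendsto (fun z => conj z ^ m * z ^ n * ((‖z‖ ^ (-(2 * s)) : ℝ) : ℂ) * F z) (𝓝[≠] 0) (𝓝 C) := by
  obtain ⟨Φ, hΦ, h0, hF⟩ := h
  have := hΦ.continuousAt.tendsto.comp (tendsto_prod_normPow hs)
  rw [h0] at this
  refine this.congr' ?_
  filter_upwards [hF, self_mem_nhdsWithin] with z hz hz0
  have hz0' : z ≠ 0 := hz0
  have hc0 : conj z ≠ 0 := by simpa using hz0'
  have hn : 0 < ‖z‖ := norm_pos_iff.2 hz0'
  have hp : ((‖z‖ ^ (-(2 * s)) : ℝ) : ℂ) * normPow s z = 1 := by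
    rw [normPow, ← Complex.ofReal_mul, ← Real.rpow_add hn]
    simp
  rw [hz, Function.comp_apply, map_inv₀, map_pow]
  field_simp
  linear_combination -Φ (z, normPow s z) * hp

/-- The first derivative of `log (1 + u)` for `u` of size `|z| ^ (2 s)`. -/
theorem HasNormPowForm.dz_log_one_add (hs : 0 < s) {u : ℂ → ℝ}
    (h : HasNormPowForm s 0 0 C (fun z => (u z : ℂ))) :
    (∀ᶠ z in 𝓝[≠] (0 : ℂ), DifferentiableAt ℝ (fun w => (Real.log (1 + u w) : ℂ)) z) ∧
      HasNormPowForm s 1 0 (s * C) (dz fun z => (Real.log (1 + u z) : ℂ)) := by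
  obtain ⟨hd, ⟨Φ₁, hΦ₁, h1, hF₁⟩, -⟩ := h.dz_dzbar hs
  obtain ⟨Φ, hΦ, h0, hF⟩ := h
  have hsnd : AnalyticAt ℝ (fun p : ℂ × ℝ => (p.2 : ℂ)) 0 :=
    (Complex.ofRealCLM.analyticAt _).comp analyticAt_snd
  have hden : AnalyticAt ℝ (fun p : ℂ × ℝ => 1 + (p.2 : ℂ) * Φ p) 0 :=
    analyticAt_const.add (hsnd.mul hΦ)
  have hden0 : (1 + (((0 : ℂ × ℝ).2 : ℝ) : ℂ) * Φ 0) ≠ 0 := by simp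
  have hne : ∀ᶠ z in 𝓝[≠] (0 : ℂ), 1 + u z ≠ 0 := by
    filter_upwards [(tendsto_prod_normPow hs).eventually
      (hden.continuousAt.eventually_ne hden0), hF] with z hz hz'
    intro hu
    apply hz
    have := congrArg (fun x : ℝ => (x : ℂ)) hu
    simp only [Complex.ofReal_add, hz'] at this
    simpa using this
  have hdu : ∀ᶠ z in 𝓝[≠] (0 : ℂ), DifferentiableAt ℝ u z := hd.mono fun z hz => by
    exact Complex.reCLM.differentiableAt.comp z hz
  -- Here ∂ log(1 + u) = ∂u / (1 + u) and 1 + u = 1 + t Φ, which is analytic in (z, t) with value 1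
  -- at the origin, so the leading coefficient is that of ∂u.
  refine ⟨?_, fun p => Φ₁ p / (1 + p.2 * Φ p), hΦ₁.div hden hden0, by simp [h1], ?_⟩
  · filter_upwards [hdu, hne] with z hz hz'
    exact ((hz.const_add 1).log hz').ofReal_comp_complex
  · filter_upwards [hdu, hne, hF, hF₁] with z hz hz' hu hu₁
    have hl : HasFDerivAt (fun w => Real.log (1 + u w)) ((1 + u z)⁻¹ • fderiv ℝ u z) z :=
      (hz.hasFDerivAt.const_add 1).log hz'
    rw [dz_ofReal_comp hz] at hu₁
    rw [dz_ofReal_comp hl.differentiableAt, hl.fderiv]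
    have hz'' : (1 + (u z : ℂ)) ≠ 0 := by exact_mod_cast hz'
    have e : 1 + (normPow s z : ℂ) * Φ (z, normPow s z) = 1 + u z := by rw [hu]; simp
    simp only [smul_apply, smul_eq_mul, Complex.ofReal_mul, Complex.ofReal_inv, Complex.ofReal_add,
      Complex.ofReal_one, e]
    rw [← mul_div_assoc, ← hu₁]
    field_simp

end NormPowForm

end

/-! ### Holomorphic part minus singular part -/

noncomputable section

open ComplexConjugate

/-- Near `0`, `F` is the difference of a holomorphic function and a function as in
`HasNormPowForm`. -/
def HasNormPowExpansion (s : ℝ) (n m : ℕ) (C : ℂ) (F : ℂ → ℂ) : Prop :=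
  ∃ k R : ℂ → ℂ, AnalyticAt ℂ k 0 ∧ HasNormPowForm s n m C R ∧
    F =ᶠ[𝓝[≠] 0] fun z => k z - R z

section NormPowExpansion

variable {s : ℝ} {n m : ℕ} {C : ℂ} {F : ℂ → ℂ}

theorem AnalyticAt.eventually_hasDerivAt_punctured {k : ℂ → ℂ} (hk : AnalyticAt ℂ k 0) :
    ∀ᶠ z in 𝓝[≠] (0 : ℂ), HasDerivAt k (deriv k z) z :=
  (hk.eventually_analyticAt.filter_mono nhdsWithin_le_nhds).mono
    fun _ h => h.differentiableAt.hasDerivAt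

theorem HasNormPowExpansion.form_dz (hs : 0 < s) (h : HasNormPowExpansion s n m C F) :
    HasNormPowExpansion s (n + 1) m ((s - n) * C) (dz F) := by
  obtain ⟨k, R, hk, hR, hF⟩ := h
  obtain ⟨hd, hR', -⟩ := hR.dz_dzbar hs
  refine ⟨deriv k, _, hk.deriv, hR', hF.dz_dzbar.1.trans ?_⟩
  filter_upwards [hd, hk.eventually_hasDerivAt_punctured] with z hz hz'
  rw [dz_sub hz'.differentiableAt_real hz, dz_of_hasDerivAt hz']

/-- The operator ∂̄ annihilates the holomorphic part, so a pure singular form remains. -/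
theorem HasNormPowExpansion.form_dzbar (hs : 0 < s) (h : HasNormPowExpansion s n m C F) :
    HasNormPowForm s n (m + 1) (-((s - m) * C)) (dzbar F) := by
  obtain ⟨k, R, hk, hR, hF⟩ := h
  obtain ⟨hd, -, hR'⟩ := hR.dz_dzbar hs
  refine hR'.neg.congr (hF.dz_dzbar.2.trans ?_)
  filter_upwards [hd, hk.eventually_hasDerivAt_punctured] with z hz hz'
  rw [dzbar_sub hz'.differentiableAt_real hz, dzbar_of_hasDerivAt hz', zero_sub]

theorem HasNormPowExpansion.iterate_dz (hs : 0 < s) (h : HasNormPowExpansion s 1 m C F) (n : ℕ) :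
    HasNormPowExpansion s (n + 1) m
      (((-1) ^ n * (ascPochhammer ℝ n).eval (1 - s) : ℝ) * C) (dz^[n] F) := by
  induction n with
  | zero => simpa using h
  | succ n ih =>
    have := ih.form_dz hs
    rw [Function.iterate_succ_apply', ascPochhammer_succ_eval]
    convert this using 1
    push_cast
    ring

theorem HasNormPowForm.iterate_dzbar (hs : 0 < s) (h : HasNormPowForm s n 1 C F) (m : ℕ) :
    HasNormPowForm s n (m + 1)
      (((-1) ^ m * (ascPochhammer ℝ m).eval (1 - s) : ℝ) * C) (dzbar^[m] F) := by
  induction m with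
  | zero => simpa using h
  | succ m ih =>
    have := (ih.dz_dzbar hs).2.2
    rw [Function.iterate_succ_apply', ascPochhammer_succ_eval]
    convert this using 1
    push_cast
    ring

theorem tendsto_norm_rpow_punctured {t : ℝ} (ht : 0 < t) :
    Tendsto (fun z : ℂ => ‖z‖ ^ t) (𝓝[≠] 0) (𝓝 0) := by
  have := tendsto_normPow (half_pos ht)
  refine this.congr fun z => ?_
  rw [normPow]
  ring_nf

/-- The condition 2s < n makes z^n |z|^(-2s) tend to 0, which suppresses the holomorphic part after
rescaling. It is the source of the case distinction in (iii). -/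
theorem HasNormPowExpansion.tendsto (hs : 0 < s) (hn : 2 * s < n)
    (h : HasNormPowExpansion s n 0 C F) :
    Tendsto (fun z => z ^ n * ((‖z‖ ^ (-(2 * s)) : ℝ) : ℂ) * F z) (𝓝[≠] 0) (𝓝 (-C)) := by
  obtain ⟨k, R, hk, hR, hF⟩ := h
  have h1 : Tendsto (fun z : ℂ => z ^ n * ((‖z‖ ^ (-(2 * s)) : ℝ) : ℂ)) (𝓝[≠] 0) (𝓝 0) := by
    rw [tendsto_zero_iff_norm_tendsto_zero]
    refine (tendsto_norm_rpow_punctured (sub_pos.2 hn)).congr' ?_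
    filter_upwards [self_mem_nhdsWithin] with z hz
    have hz' : 0 < ‖z‖ := norm_pos_iff.2 hz
    rw [norm_mul, norm_pow, Complex.norm_real, Real.norm_of_nonneg (by positivity),
      ← Real.rpow_natCast, ← Real.rpow_add hz', sub_eq_add_neg]
  have h2 := (h1.mul (hk.continuousAt.tendsto.mono_left nhdsWithin_le_nhds)).sub (hR.tendsto hs)
  rw [zero_mul, zero_sub] at h2
  refine h2.congr' ?_
  filter_upwards [hF] with z hz
  rw [hz, pow_zero, one_mul]
  ring

theorem HasNormPowForm.tendsto_zero (hs : 1 / 2 < s) (h : HasNormPowForm s 1 0 C F) :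
    Tendsto F (𝓝[≠] 0) (𝓝 0) := by
  have h1 : Tendsto (fun z : ℂ => z⁻¹ * (normPow s z : ℂ)) (𝓝[≠] 0) (𝓝 0) := by
    rw [tendsto_zero_iff_norm_tendsto_zero]
    refine (tendsto_norm_rpow_punctured (show 0 < 2 * s - 1 by linarith)).congr' ?_
    filter_upwards [self_mem_nhdsWithin] with z hz
    have hz' : 0 < ‖z‖ := norm_pos_iff.2 hz
    rw [norm_mul, norm_inv, Complex.norm_real, normPow, Real.norm_of_nonneg (by positivity),
      Real.rpow_sub_one hz'.ne']
    ring
  obtain ⟨Φ, hΦ, h0, hF⟩ := h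
  have h2 := h1.mul (hΦ.continuousAt.tendsto.comp (tendsto_prod_normPow (by linarith : 0 < s)))
  rw [zero_mul] at h2
  refine h2.congr' ?_
  filter_upwards [hF] with z hz
  rw [hz]
  simp

theorem isBigO_rpow_half_of_isBigO_norm {f : ℂ → ℂ} (h : f =O[𝓝[≠] 0] fun z => z) :
    f =O[𝓝[≠] 0] fun z : ℂ => ‖z‖ ^ (1 / 2 : ℝ) := by
  refine h.trans (Asymptotics.IsBigO.of_bound 1 ?_)
  filter_upwards [self_mem_nhdsWithin,
    nhdsWithin_le_nhds (Metric.ball_mem_nhds (0 : ℂ) one_pos)] with z hz hz1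
  have hz' : 0 < ‖z‖ := norm_pos_iff.2 hz
  rw [Real.norm_of_nonneg (by positivity), one_mul]
  calc ‖z‖ = ‖z‖ ^ (1 : ℝ) := (Real.rpow_one _).symm
    _ ≤ ‖z‖ ^ (1 / 2 : ℝ) :=
      Real.rpow_le_rpow_of_exponent_ge hz' (by simpa using (mem_ball_zero_iff.1 hz1).le) (by norm_num)

/-- For s = 1/2 the prefactor |z| / z equals z̄ / |z|, which has modulus one, and Φ(z, |z|) - Φ(0) =
O(|z|) because Φ is differentiable. -/
theorem HasNormPowForm.isBigO_sub (h : HasNormPowForm (1 / 2) 1 0 C F) :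
    (fun z => F z - C * (conj z / (‖z‖ : ℂ))) =O[𝓝[≠] 0] fun z => z := by
  obtain ⟨Φ, hΦ, h0, hF⟩ := h
  have hO := hΦ.differentiableAt.isBigO_sub.comp_tendsto
    (tendsto_prod_normPow (by norm_num : (0 : ℝ) < 1 / 2))
  have hO2 : (fun z : ℂ => ((z, normPow (1 / 2) z) : ℂ × ℝ)) =O[𝓝[≠] 0] fun z => z := by
    refine Asymptotics.IsBigO.of_bound 1 (Eventually.of_forall fun z => ?_)
    rw [normPow, Prod.norm_mk]
    simp
  refine Asymptotics.IsBigO.trans (Asymptotics.IsBigO.of_bound 1 ?_) (hO.trans ?_)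
  · filter_upwards [hF, self_mem_nhdsWithin] with z hz hz0
    have hz0' : z ≠ 0 := hz0
    have hn : (‖z‖ : ℂ) ≠ 0 := by simpa using hz0'
    have hN : (normPow (1 / 2) z : ℂ) = ‖z‖ := by rw [normPow]; simp
    have e : (z ^ 1)⁻¹ * conj (z ^ 0)⁻¹ * (‖z‖ : ℂ) = conj z / ‖z‖ := by
      have := Complex.mul_conj' z
      simp only [pow_one, pow_zero, inv_one, map_one, mul_one]
      field_simp
      rw [← this, mul_comm]
    have e2 : F z - C * (conj z / (‖z‖ : ℂ)) =
        conj z / (‖z‖ : ℂ) * (Φ (z, normPow (1 / 2) z) - Φ 0) := by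
      rw [hz, hN, e, h0]
      ring
    have e3 : ‖conj z / (‖z‖ : ℂ)‖ = 1 := by
      rw [norm_div, RCLike.norm_conj, Complex.norm_real, norm_norm, div_self (by simpa using hz0')]
    rw [e2, norm_mul, e3]
    simp
  · simpa [Function.comp_def] using hO2

end NormPowExpansion

theorem HasDerivAt.dz_re {H : ℂ → ℂ} {H' z : ℂ} (h : HasDerivAt H H' z) :
    DifferentiableAt ℝ (fun w => ((H w).re : ℂ)) z ∧ dz (fun w => ((H w).re : ℂ)) z = H' / 2 := by
  have h1 : HasFDerivAt (fun w => (H w).re) (Complex.reCLM.comp (fderiv ℝ H z)) z :=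
    Complex.reCLM.hasFDerivAt.comp z h.differentiableAt_real.hasFDerivAt
  refine ⟨h1.differentiableAt.ofReal_comp_complex, ?_⟩
  rw [dz_ofReal_comp h1.differentiableAt, h1.fderiv]
  simp only [ContinuousLinearMap.comp_apply, fderiv_real_apply h, Complex.reCLM_apply]
  apply Complex.ext <;> simp

/-! ### Derivatives of Re H - log(1 + u) -/

section Remainder

variable {s : ℝ} {L' : ℂ} {H v : ℂ → ℂ} {u : ℂ → ℝ}

theorem dz_remainder_form (hs : 0 < s) (hH : AnalyticAt ℂ H 0)
    (hu : HasNormPowForm s 0 0 L' (fun z => (u z : ℂ)))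
    (hv : v =ᶠ[𝓝[≠] 0] fun z => ((H z).re : ℂ) - (Real.log (1 + u z) : ℂ)) :
    ∃ R, HasNormPowForm s 1 0 (s * L') R ∧ dz v =ᶠ[𝓝[≠] 0] fun z => deriv H z / 2 - R z := by
  obtain ⟨hd, hR⟩ := hu.dz_log_one_add hs
  refine ⟨_, hR, hv.dz_dzbar.1.trans ?_⟩
  filter_upwards [hd, hH.eventually_hasDerivAt_punctured] with z hz hz'
  rw [dz_sub hz'.dz_re.1 hz, hz'.dz_re.2]

theorem remainder_tendsto_of_half_lt (hs : 1 / 2 < s) (hH : AnalyticAt ℂ H 0)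
    (hu : HasNormPowForm s 0 0 L' (fun z => (u z : ℂ)))
    (hv : v =ᶠ[𝓝[≠] 0] fun z => ((H z).re : ℂ) - (Real.log (1 + u z) : ℂ)) :
    Tendsto (dz v) (𝓝[≠] 0) (𝓝 (deriv H 0 / 2)) := by
  obtain ⟨R, hR, hd⟩ := dz_remainder_form (by linarith) hH hu hv
  have h1 := (hH.deriv.continuousAt.tendsto.mono_left
    (nhdsWithin_le_nhds (s := {0}ᶜ))).div_const 2
  have := h1.sub (hR.tendsto_zero hs)
  rw [sub_zero] at this
  exact this.congr' hd.symm

theorem remainder_isBigO_of_eq_half (hH : AnalyticAt ℂ H 0)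
    (hu : HasNormPowForm (1 / 2) 0 0 L' (fun z => (u z : ℂ)))
    (hv : v =ᶠ[𝓝[≠] 0] fun z => ((H z).re : ℂ) - (Real.log (1 + u z) : ℂ)) :
    (fun z => dz v z - (deriv H 0 / 2 - L' / 2 * (conj z / (‖z‖ : ℂ)))) =O[𝓝[≠] 0]
      fun z : ℂ => ‖z‖ ^ (1 / 2 : ℝ) := by
  obtain ⟨R, hR, hd⟩ := dz_remainder_form (by norm_num) hH hu hv
  have h1 := (hH.deriv.differentiableAt.isBigO_sub.mono
    (nhdsWithin_le_nhds (s := {0}ᶜ))).const_mul_left (1 / 2)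
  simp only [sub_zero] at h1
  refine isBigO_rpow_half_of_isBigO_norm ((h1.sub hR.isBigO_sub).congr' ?_ .rfl)
  filter_upwards [hd] with z hz
  rw [hz]
  push_cast
  ring

theorem remainder_tendsto_iterate_dz (hs : 0 < s) (hH : AnalyticAt ℂ H 0)
    (hu : HasNormPowForm s 0 0 L' (fun z => (u z : ℂ)))
    (hv : v =ᶠ[𝓝[≠] 0] fun z => ((H z).re : ℂ) - (Real.log (1 + u z) : ℂ)) {n : ℕ}
    (hn : 2 * s < (n + 1 : ℕ)) :
    Tendsto (fun z => z ^ (n + 1) * ((‖z‖ ^ (-(2 * s)) : ℝ) : ℂ) * dz^[n + 1] v z) (𝓝[≠] 0)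
      (𝓝 (-(((-1) ^ n * (ascPochhammer ℝ n).eval (1 - s) : ℝ) * (s * L')))) := by
  obtain ⟨R, hR, hd⟩ := dz_remainder_form hs hH hu hv
  have hE : HasNormPowExpansion s 1 0 (s * L') (dz v) :=
    ⟨_, R, hH.deriv.div analyticAt_const two_ne_zero, hR, hd⟩
  exact (hE.iterate_dz hs n).tendsto hs hn

theorem remainder_tendsto_iterate_dzbar_dz (hs : 0 < s) (hH : AnalyticAt ℂ H 0)
    (hu : HasNormPowForm s 0 0 L' (fun z => (u z : ℂ)))
    (hv : v =ᶠ[𝓝[≠] 0] fun z => ((H z).re : ℂ) - (Real.log (1 + u z) : ℂ)) (m n : ℕ) :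
    Tendsto (fun z => conj z ^ (m + 1) * z ^ (n + 1) * ((‖z‖ ^ (-(2 * s)) : ℝ) : ℂ) *
        dzbar^[m + 1] (dz^[n + 1] v) z) (𝓝[≠] 0)
      (𝓝 (((-1) ^ m * (ascPochhammer ℝ m).eval (1 - s) : ℝ) * -(s *
        (((-1) ^ n * (ascPochhammer ℝ n).eval (1 - s) : ℝ) * (s * L'))))) := by
  obtain ⟨R, hR, hd⟩ := dz_remainder_form hs hH hu hv
  have hE : HasNormPowExpansion s 1 0 (s * L') (dz v) :=
    ⟨_, R, hH.deriv.div analyticAt_const two_ne_zero, hR, hd⟩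
  have h1 := (hE.iterate_dz hs n).form_dzbar hs
  rw [Nat.cast_zero, sub_zero] at h1
  exact (HasNormPowForm.iterate_dzbar hs h1 m).tendsto hs

end Remainder

end

/-! ### The density near the origin -/

noncomputable section

open ComplexConjugate

theorem gaussF_conj {a b c : ℝ} (ha : 0 < a) (hb : 0 < b) (hc : 0 < c) {z : ℂ} (hz : ‖z‖ < 1) :
    gaussF a b c (conj z) = conj (gaussF a b c z) := by
  have h1 := hasSum_gaussF ha hb hc (z := conj z) (by rwa [RCLike.norm_conj])
  have h2 := (Complex.hasSum_conj'.2 (hasSum_gaussF ha hb hc hz)).of_forall_eq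
    (f := fun n => ordinaryHypergeometricCoefficient (a : ℂ) b c n * conj z ^ n) fun n => ?_
  · exact h1.unique h2
  · simp only [ordinaryHypergeometricCoefficient, ← ofReal_ascPochhammer_eval, map_mul, map_inv₀,
      Complex.conj_ofReal, map_natCast, map_pow]

theorem analyticAt_gaussF {a b c : ℝ} (ha : 0 < a) (hb : 0 < b) (hc : 0 < c) :
    AnalyticAt ℂ (gaussF a b c) 0 :=
  (differentiableOn_gaussF ha hb hc).analyticAt (Metric.ball_mem_nhds 0 one_pos)

theorem deriv_gaussF_zero {a b c : ℝ} (ha : 0 < a) (hb : 0 < b) (hc : 0 < c) :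
    deriv (gaussF a b c) 0 = a * b / c := by
  have h := gaussF_ode ha hb hc (z := 0) (by simp)
  have hc' : (c : ℂ) ≠ 0 := by exact_mod_cast hc.ne'
  rw [gaussF_zero] at h
  field_simp
  linear_combination h

theorem φ₁_eq {a b c : ℝ} (hb : 0 < b) (hbc : b < c) {z : ℂ} (hz : ‖z‖ < 1) :
    φ₁ a b c z = gaussF a b c z := (hypF_spec a hb hbc).2 (by simpa using hz)

theorem dense_doubleSlit : Dense doubleSlit := by
  refine ((dense_compl_singleton (0 : ℝ)).preimage Complex.isOpenMap_im).mono fun z hz => ?_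
  have hz' : z.im ≠ 0 := hz
  exact ⟨Or.inr hz', Or.inr (by simpa using hz')⟩

section Parameters

variable {a b c : ℝ}

/-- The coefficient of `|F(a, b; c; z)|²` in `hypM`. -/
def coeffP (a b c : ℝ) : ℝ := K₁ a b c + Real.Gamma (a + b - c + 1) * Real.Gamma (1 - c) /
  (Real.Gamma (b - c + 1) * Real.Gamma (a - c + 1))

/-- The coefficient of `|z|^(2 - 2c) |F(a - c + 1, b - c + 1; 2 - c; z)|²` in `hypM`. -/
def coeffQ (a b c : ℝ) : ℝ := K₂ a b c *
  (Real.Gamma (a + b - c + 1) * Real.Gamma c / ((1 - c) * (Real.Gamma a * Real.Gamma b))) ^ 2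

theorem K₂_mul_connection (ha : 0 < a) (hb : 0 < b) (hc : c < 1) :
    K₂ a b c * (Real.Gamma (a + b - c + 1) * Real.Gamma (1 - c) /
      (Real.Gamma (b - c + 1) * Real.Gamma (a - c + 1))) = -1 := by
  have h1 := (Real.Gamma_pos_of_pos (show 0 < a + b - c + 1 by linarith)).ne'
  have h2 := (Real.Gamma_pos_of_pos (show 0 < 1 - c by linarith)).ne'
  have h3 := (Real.Gamma_pos_of_pos (show 0 < a - c + 1 by linarith)).ne'
  have h4 := (Real.Gamma_pos_of_pos (show 0 < b - c + 1 by linarith)).ne'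
  rw [K₂, show a + 1 - c = a - c + 1 by ring, show b + 1 - c = b - c + 1 by ring,
    show a + b + 1 - c = a + b - c + 1 by ring]
  field_simp

theorem K₂_neg (ha : 0 < a) (hb : 0 < b) (hc : c < 1) : K₂ a b c < 0 := by
  have h1 := Real.Gamma_pos_of_pos (show 0 < a + b + 1 - c by linarith)
  have h2 := Real.Gamma_pos_of_pos (show 0 < 1 - c by linarith)
  have h3 := Real.Gamma_pos_of_pos (show 0 < a + 1 - c by linarith)
  have h4 := Real.Gamma_pos_of_pos (show 0 < b + 1 - c by linarith)
  exact neg_neg_of_pos (by positivity)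

theorem sin_pi_mul_pos {x : ℝ} (h0 : 0 < x) (h1 : x < 1) : 0 < Real.sin (Real.pi * x) :=
  Real.sin_pos_of_pos_of_lt_pi (by positivity) (by nlinarith [Real.pi_pos])

/-- Let A be the first connection coefficient and G = F(a, b, c; 1). Then K₂ A = -1 and K₁ G = -1,
so K₁ K₂ A G = 1, while the reflection identity says that A G exceeds 1 by a positive quantity. -/
theorem K₁_mul_K₂_lt_one (ha : 0 < a) (hb : 0 < b) (hab : a + b < c) (hc : c < 1) :
    K₁ a b c * K₂ a b c < 1 := by
  have hid := gamma_reflection_identity ha hb hab hc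
  have hK := K₂_mul_connection ha hb hc
  have g1 := Real.Gamma_pos_of_pos (show 0 < a + b - c + 1 by linarith)
  have g2 := Real.Gamma_pos_of_pos (show 0 < c by linarith)
  have g3 := Real.Gamma_pos_of_pos ha
  have g4 := Real.Gamma_pos_of_pos hb
  have g5 := Real.Gamma_pos_of_pos (show 0 < 2 - c by linarith)
  have g6 := Real.Gamma_pos_of_pos (show 0 < c - a - b by linarith)
  have g7 := Real.Gamma_pos_of_pos (show 0 < 1 - a by linarith)
  have g8 := Real.Gamma_pos_of_pos (show 0 < 1 - b by linarith)
  have g9 := Real.Gamma_pos_of_pos (show 0 < c - a by linarith)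
  have g10 := Real.Gamma_pos_of_pos (show 0 < c - b by linarith)
  have hc1 : 0 < 1 - c := by linarith
  have hpos : 0 < (Real.Gamma (a + b - c + 1) * Real.Gamma c /
      ((1 - c) * (Real.Gamma a * Real.Gamma b))) *
      (Real.Gamma (2 - c) * Real.Gamma (c - a - b) / (Real.Gamma (1 - a) * Real.Gamma (1 - b))) := by
    positivity
  have hK₁ : K₁ a b c * (Real.Gamma c * Real.Gamma (c - a - b) /
      (Real.Gamma (c - a) * Real.Gamma (c - b))) = -1 := by
    rw [K₁]
    field_simp
  have hG : 0 < Real.Gamma c * Real.Gamma (c - a - b) /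
      (Real.Gamma (c - a) * Real.Gamma (c - b)) := by positivity
  set A := Real.Gamma (a + b - c + 1) * Real.Gamma (1 - c) /
    (Real.Gamma (b - c + 1) * Real.Gamma (a - c + 1)) with hA
  set G := Real.Gamma c * Real.Gamma (c - a - b) / (Real.Gamma (c - a) * Real.Gamma (c - b)) with hG'
  have hAG : 1 < A * G := by linarith
  have hprod : K₁ a b c * K₂ a b c * (A * G) = 1 := by
    linear_combination (K₁ a b c * G) * hK - hK₁
  by_contra! hcon
  nlinarith

theorem coeffP_eq (ha : 0 < a) (hb : 0 < b) (hc : c < 1) :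
    coeffP a b c = (K₁ a b c * K₂ a b c - 1) / K₂ a b c := by
  have h := K₂_neg ha hb hc
  rw [eq_div_iff h.ne, coeffP]
  linear_combination K₂_mul_connection ha hb hc

theorem coeffP_pos (ha : 0 < a) (hb : 0 < b) (hab : a + b < c) (hc : c < 1) :
    0 < coeffP a b c := by
  rw [coeffP_eq ha hb hc]
  exact div_pos_of_neg_of_neg (sub_neg.2 (K₁_mul_K₂_lt_one ha hb hab hc)) (K₂_neg ha hb hc)

/-- This explains the shape of L: dividing K₂ B² by (K₁ K₂ - 1) / K₂ gives the prefactor of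
`constL`, and B² carries the squared Gamma quotient together with (1 - c)^(-2). -/
theorem coeffQ_div_coeffP (ha : 0 < a) (hb : 0 < b) (hab : a + b < c) (hc : c < 1) :
    coeffQ a b c / coeffP a b c = constL a b c / (1 - c) ^ 2 := by
  have h := (K₂_neg ha hb hc).ne
  have h2 : K₁ a b c * K₂ a b c - 1 ≠ 0 := (sub_neg.2 (K₁_mul_K₂_lt_one ha hb hab hc)).ne
  have h3 := (Real.Gamma_pos_of_pos ha).ne'
  have h4 := (Real.Gamma_pos_of_pos hb).ne'
  have hc1 : 1 - c ≠ 0 := by linarith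
  rw [coeffP_eq ha hb hc, coeffQ, constL]
  field_simp

theorem constL_ne_zero (ha : 0 < a) (hb : 0 < b) (hab : a + b < c) (hc : c < 1) :
    constL a b c ≠ 0 := by
  have g1 := (Real.Gamma_pos_of_pos (show 0 < a + b - c + 1 by linarith)).ne'
  have g2 := (Real.Gamma_pos_of_pos (show 0 < c by linarith)).ne'
  have g3 := (Real.Gamma_pos_of_pos ha).ne'
  have g4 := (Real.Gamma_pos_of_pos hb).ne'
  have h := (K₂_neg ha hb hc).ne
  have h2 : K₁ a b c * K₂ a b c - 1 ≠ 0 := (sub_neg.2 (K₁_mul_K₂_lt_one ha hb hab hc)).ne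
  rw [constL]
  positivity

theorem K₃_pos (ha : 0 < a) (hb : 0 < b) (hab : a + b < c) (hc : c < 1) : 0 < K₃ a b c := by
  have g1 := Real.Gamma_pos_of_pos (show 0 < a + b + 1 - c by linarith)
  have g2 := Real.Gamma_pos_of_pos (show 0 < c by linarith)
  have g3 := Real.Gamma_pos_of_pos ha
  have g4 := Real.Gamma_pos_of_pos hb
  have s1 := sin_pi_mul_pos ha (by linarith)
  have s2 := sin_pi_mul_pos hb (by linarith)
  have s3 := sin_pi_mul_pos (show 0 < c - a by linarith) (by linarith)
  have s4 := sin_pi_mul_pos (show 0 < c - b by linarith) (by linarith)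
  rw [K₃]
  positivity

/-- Substitute φ₂ = A f - B w with w = z^(1-c) g. The real coefficients, and the principal power off
the cut, give φ₂(z̄) = conj φ₂(z). The coefficient of Re(f w̄) is then -2B (K₂ A + 1) = 0, and that
of |f|² is K₁ + K₂ A² + 2A = K₁ + A. -/
theorem hypM_eq (ha : 0 < a) (hb : 0 < b) (hab : a + b < c) (hc : c < 1) {z : ℂ}
    (hz : z ∈ Complex.slitPlane) (hz1 : ‖z‖ < 1) :
    hypM a b c z = coeffP a b c * ‖gaussF a b c z‖ ^ 2 +
      coeffQ a b c * (normPow (1 - c) z * ‖gaussF (a - c + 1) (b - c + 1) (2 - c) z‖ ^ 2) := by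
  have hc0 : 0 < c := by linarith
  have hzc1 : ‖conj z‖ < 1 := by rwa [RCLike.norm_conj]
  have hzc : conj z ∈ Complex.slitPlane := by
    rcases hz with h | h
    · exact Or.inl (by simpa using h)
    · exact Or.inr (by simpa using h)
  have hcpow : conj z ^ (1 - c : ℂ) = conj (z ^ (1 - c : ℂ)) := by
    rw [Complex.conj_cpow _ _ (Complex.slitPlane_arg_ne_pi hz)]
    simp
  have hnorm : normPow (1 - c) z = ‖z ^ (1 - c : ℂ)‖ ^ 2 := by
    rw [← Complex.ofReal_one, ← Complex.ofReal_sub, Complex.norm_cpow_real, normPow,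
      ← Real.rpow_natCast, ← Real.rpow_mul (norm_nonneg _)]
    congr 1
    push_cast
    ring
  have e₁ := φ₁_eq (a := a) hb (show b < c by linarith) hz1
  have e₂ : φ₂ a b c z = _ := hypF_one_sub_eq ha hb hab hc hz hz1
  have e₃ : φ₂ a b c (conj z) = _ := hypF_one_sub_eq ha hb hab hc hzc hzc1
  rw [gaussF_conj ha hb hc0 hz1, gaussF_conj (by linarith) (by linarith) (by linarith) hz1, hcpow,
    ← map_mul] at e₃
  have hK := K₂_mul_connection ha hb hc
  rw [hypM, e₁, e₂, e₃, hnorm, ← mul_pow, ← norm_mul, coeffP, coeffQ]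
  set A := Real.Gamma (a + b - c + 1) * Real.Gamma (1 - c) /
    (Real.Gamma (b - c + 1) * Real.Gamma (a - c + 1)) with hA
  set B := Real.Gamma (a + b - c + 1) * Real.Gamma c /
    ((1 - c) * (Real.Gamma a * Real.Gamma b)) with hB
  generalize z ^ (1 - c : ℂ) * gaussF (a - c + 1) (b - c + 1) (2 - c) z = w, gaussF a b c z = f
  simp only [Complex.sq_norm, Complex.normSq_apply, Complex.add_re, Complex.add_im, Complex.mul_re,
    Complex.mul_im, Complex.ofReal_re, Complex.ofReal_im, Complex.conj_re, Complex.conj_im]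
  linear_combination (A * (f.re * f.re + f.im * f.im) - 2 * B * (f.re * w.re + f.im * w.im)) * hK

/-- The quotient of the two local solutions at `0`, without the factor `z ^ (1 - c)`. -/
def solutionRatio (a b c : ℝ) (z : ℂ) : ℂ :=
  gaussF (a - c + 1) (b - c + 1) (2 - c) z / gaussF a b c z

/-- The non-smooth term `|z| ^ (2 - 2c)` of the density, with its coefficient. -/
def singularTerm (a b c : ℝ) (z : ℂ) : ℝ :=
  constL a b c / (1 - c) ^ 2 * (normPow (1 - c) z * ‖solutionRatio a b c z‖ ^ 2)

/-- The holomorphic function whose real part is the smooth part of the remainder. -/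
def smoothPart (a b c : ℝ) (z : ℂ) : ℂ :=
  (Real.log (K₃ a b c) - Real.log (coeffP a b c) : ℝ) -
    (a + b - c + 1) * Complex.log (1 - z) - 2 * Complex.log (gaussF a b c z)

theorem analyticAt_solutionRatio (ha : 0 < a) (hb : 0 < b) (hab : a + b < c) (hc : c < 1) :
    AnalyticAt ℂ (solutionRatio a b c) 0 :=
  (analyticAt_gaussF (by linarith) (by linarith) (by linarith)).div
    (analyticAt_gaussF ha hb (by linarith)) (by simp [gaussF_zero])

theorem analyticAt_smoothPart (ha : 0 < a) (hb : 0 < b) (hab : a + b < c) :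
    AnalyticAt ℂ (smoothPart a b c) 0 := by
  refine (analyticAt_const.sub (analyticAt_const.mul ?_)).sub (analyticAt_const.mul ?_)
  · exact (analyticAt_const.sub analyticAt_id).clog (by simp)
  · exact (analyticAt_gaussF ha hb (by linarith)).clog (by simp [gaussF_zero])

theorem deriv_smoothPart_zero (ha : 0 < a) (hb : 0 < b) (hab : a + b < c) :
    deriv (smoothPart a b c) 0 = a + b - c + 1 - 2 * (a * b / c) := by
  have hc : 0 < c := by linarith
  have h1 : HasDerivAt (fun z : ℂ => Complex.log (1 - z)) (-1 / (1 - 0)) 0 :=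
    ((hasDerivAt_id' (0 : ℂ)).const_sub 1).clog (by simp)
  have h2 := (hasDerivAt_gaussF ha hb hc (z := 0) (by simp)).clog (by simp [gaussF_zero])
  have h3 := ((h1.const_mul (a + b - c + 1 : ℂ)).const_sub
    ((Real.log (K₃ a b c) - Real.log (coeffP a b c) : ℝ) : ℂ)).sub (h2.const_mul 2)
  have h4 : deriv (smoothPart a b c) 0 = _ := h3.deriv
  rw [h4, gaussF_zero, deriv_gaussF_zero ha hb hc]
  ring

theorem hasNormPowForm_singularTerm (ha : 0 < a) (hb : 0 < b) (hab : a + b < c) (hc : c < 1) :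
    HasNormPowForm (1 - c) 0 0 ((constL a b c / (1 - c) ^ 2 : ℝ) : ℂ)
      (fun z => (singularTerm a b c z : ℂ)) := by
  have hG := analyticAt_solutionRatio ha hb hab hc
  have hG' : AnalyticAt ℝ (fun p : ℂ × ℝ => solutionRatio a b c p.1) 0 :=
    (hG.restrictScalars (𝕜 := ℝ)).comp (f := fun p : ℂ × ℝ => p.1) (x := 0) analyticAt_fst
  have hGc : AnalyticAt ℝ (fun p : ℂ × ℝ => conj (solutionRatio a b c p.1)) 0 :=
    (Complex.conjCLE.toContinuousLinearMap.analyticAt _).comp hG'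
  refine ⟨fun p => ((constL a b c / (1 - c) ^ 2 : ℝ) : ℂ) *
    (solutionRatio a b c p.1 * conj (solutionRatio a b c p.1)),
    analyticAt_const.mul (hG'.mul hGc), by simp [solutionRatio, gaussF_zero],
    Eventually.of_forall fun z => ?_⟩
  simp only [Complex.mul_conj', singularTerm]
  push_cast
  simp
  ring

theorem tendsto_singularTerm (ha : 0 < a) (hb : 0 < b) (hab : a + b < c) (hc : c < 1) :
    Tendsto (singularTerm a b c) (𝓝[≠] 0) (𝓝 0) := by
  have h1 := (analyticAt_solutionRatio ha hb hab hc).continuousAt.tendsto.mono_left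
    (nhdsWithin_le_nhds (s := {0}ᶜ))
  have h2 := ((tendsto_normPow (sub_pos.2 hc)).mul (h1.norm.pow 2)).const_mul
    (constL a b c / (1 - c) ^ 2)
  rw [zero_mul, mul_zero] at h2
  exact h2

theorem eventually_hypDensity_eq (ha : 0 < a) (hb : 0 < b) (hab : a + b < c) (hc : c < 1) :
    ∀ᶠ z in 𝓝[≠] (0 : ℂ), z ≠ 0 ∧ 1 - z ≠ 0 ∧ gaussF a b c z ≠ 0 ∧ 0 < 1 + singularTerm a b c z ∧
      ContDiffAt ℝ ∞ (smoothPart a b c) z ∧ ContDiffAt ℝ ∞ (singularTerm a b c) z ∧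
      extendFrom doubleSlit (fun z => 1 / (‖z‖ ^ c * ‖1 - z‖ ^ (a + b - c + 1)) *
        (K₃ a b c / hypM a b c z)) z =
      1 / (‖z‖ ^ c * ‖1 - z‖ ^ (a + b - c + 1)) * (K₃ a b c /
        (coeffP a b c * ‖gaussF a b c z‖ ^ 2 * (1 + singularTerm a b c z))) := by
  have hc0 : 0 < c := by linarith
  have hP := coeffP_pos ha hb hab hc
  have af := analyticAt_gaussF ha hb hc0
  have ar := analyticAt_solutionRatio ha hb hab hc
  have ah := analyticAt_smoothPart ha hb hab
  have hf0 : ∀ᶠ z in 𝓝 (0 : ℂ), gaussF a b c z ≠ 0 :=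
    af.continuousAt.eventually_ne (by simp [gaussF_zero])
  have hsing : ∀ᶠ z in 𝓝[≠] (0 : ℂ), 0 < 1 + singularTerm a b c z := by
    have h := (tendsto_singularTerm ha hb hab hc).const_add 1
    exact h.eventually_const_lt (by norm_num)
  have hball : ∀ᶠ z in 𝓝 (0 : ℂ), ‖z‖ < 1 := by
    filter_upwards [Metric.ball_mem_nhds (0 : ℂ) one_pos] with z hz
    simpa using hz
  filter_upwards [self_mem_nhdsWithin, nhdsWithin_le_nhds hf0, hsing, nhdsWithin_le_nhds hball,
    nhdsWithin_le_nhds af.eventually_analyticAt, nhdsWithin_le_nhds ar.eventually_analyticAt,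
    nhdsWithin_le_nhds ah.eventually_analyticAt] with z hz hfz hsz hz1 afz arz ahz
  have hz0 : z ≠ 0 := hz
  have h1z : 1 - z ≠ 0 := fun h => by
    rw [← sub_eq_zero.1 h] at hz1
    simp at hz1
  have hns : ContDiffAt ℝ ∞ (normPow (1 - c)) z :=
    (contDiffAt_norm ℝ hz0).rpow_const_of_ne (norm_ne_zero_iff.2 hz0)
  have hcs : ContDiffAt ℝ ∞ (singularTerm a b c) z :=
    contDiffAt_const.mul (hns.mul ((arz.restrictScalars (𝕜 := ℝ)).contDiffAt.norm_sq ℝ))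
  refine ⟨hz0, h1z, hfz, hsz, (ahz.restrictScalars (𝕜 := ℝ)).contDiffAt, hcs, ?_⟩
  -- The point z may lie on the negative axis, where `hypM_eq` is unavailable. The target is
  -- continuous there and agrees with the formula at nearby points of the dense set `doubleSlit`, so
  -- it is the limit.
  refine extendFrom_eq (dense_doubleSlit z) ?_
  have hcont : ContinuousAt (fun z => 1 / (‖z‖ ^ c * ‖1 - z‖ ^ (a + b - c + 1)) * (K₃ a b c /
      (coeffP a b c * ‖gaussF a b c z‖ ^ 2 * (1 + singularTerm a b c z)))) z := by
    have c1 : ContinuousAt (fun z : ℂ => ‖z‖ ^ c) z :=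
      continuous_norm.continuousAt.rpow_const (Or.inr hc0.le)
    have c2 : ContinuousAt (fun z : ℂ => ‖1 - z‖ ^ (a + b - c + 1)) z :=
      ContinuousAt.rpow_const (by fun_prop) (Or.inr (by linarith))
    have c3 := hcs.continuousAt
    have c4 := afz.continuousAt
    have n1 : ‖z‖ ^ c * ‖1 - z‖ ^ (a + b - c + 1) ≠ 0 := by
      have := norm_pos_iff.2 hz0
      have := norm_pos_iff.2 h1z
      positivity
    have n2 : coeffP a b c * ‖gaussF a b c z‖ ^ 2 * (1 + singularTerm a b c z) ≠ 0 := by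
      have := norm_pos_iff.2 hfz
      positivity
    exact (continuousAt_const.div (c1.mul c2) n1).mul (continuousAt_const.div
      ((continuousAt_const.mul (c4.norm.pow 2)).mul (continuousAt_const.add c3)) n2)
  refine (hcont.tendsto.mono_left nhdsWithin_le_nhds).congr' ?_
  filter_upwards [self_mem_nhdsWithin, 
    nhdsWithin_le_nhds (afz.continuousAt.eventually_ne hfz),
    nhdsWithin_le_nhds ((Metric.isOpen_ball (x := (0 : ℂ)) (ε := 1)).mem_nhds
      (mem_ball_zero_iff.2 hz1))] with w hw hfw hw1
  rw [hypM_eq ha hb hab hc hw.1 (mem_ball_zero_iff.1 hw1)]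
  congr 2
  have hn : ‖gaussF a b c w‖ ≠ 0 := norm_ne_zero_iff.2 hfw
  rw [singularTerm, ← coeffQ_div_coeffP ha hb hab hc, solutionRatio, norm_div]
  field_simp

theorem log_density_eq (ha : 0 < a) (hb : 0 < b) (hab : a + b < c) (hc : c < 1) {d : ℝ}
    {z : ℂ} (hz : z ≠ 0) (h1z : 1 - z ≠ 0) (hf : gaussF a b c z ≠ 0)
    (hs : 0 < 1 + singularTerm a b c z)
    (hd : d = 1 / (‖z‖ ^ c * ‖1 - z‖ ^ (a + b - c + 1)) * (K₃ a b c /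
        (coeffP a b c * ‖gaussF a b c z‖ ^ 2 * (1 + singularTerm a b c z)))) :
    0 < d ∧ Real.log d + c * Real.log ‖z‖ =
      (smoothPart a b c z).re - Real.log (1 + singularTerm a b c z) := by
  have hP := coeffP_pos ha hb hab hc
  have hK := K₃_pos ha hb hab hc
  have n1 := norm_pos_iff.2 hz
  have n2 := norm_pos_iff.2 h1z
  have n3 := norm_pos_iff.2 hf
  have p1 : 0 < ‖z‖ ^ c := by positivity
  have p2 : 0 < ‖1 - z‖ ^ (a + b - c + 1) := by positivity
  refine ⟨by rw [hd]; positivity, ?_⟩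
  rw [hd, Real.log_mul (by positivity) (by positivity), Real.log_div (by positivity) (by positivity),
    Real.log_div (by positivity) (by positivity), Real.log_one, Real.log_mul p1.ne' p2.ne',
    Real.log_mul (by positivity) hs.ne', Real.log_mul hP.ne' (by positivity), Real.log_pow,
    Real.log_rpow n1, Real.log_rpow n2, smoothPart]
  have e : ((a : ℂ) + b - c + 1) = ((a + b - c + 1 : ℝ) : ℂ) := by push_cast; rfl
  rw [e, Complex.sub_re, Complex.sub_re, Complex.re_ofReal_mul, Complex.ofReal_re, Complex.log_re,
    show (2 : ℂ) = ((2 : ℝ) : ℂ) by norm_num, Complex.re_ofReal_mul, Complex.log_re]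
  push_cast
  ring

end Parameters

end

/-! ### Assembly with s = 1 - c -/

theorem mainTheorem4 (α β γ a b c : ℝ) (v : ℂ → ℂ)
    (hα : 0 < α) (hα' : α < 1) (hβ : 0 < β) (hβ' : β < 1) (hγ : 0 < γ) (hγ' : γ ≤ 1)
    (hsum : 2 < α + β + γ)
    (ha : a = parA α β γ) (hb : b = parB α β γ) (hc : c = α)
    (hv : v = fun z => (remV α β γ z : ℂ)) :
    -- `v` is smooth in a punctured neighbourhood of the origin
    (∀ᶠ z in 𝓝[≠] (0 : ℂ), 0 < hypDensity α β γ z ∧ ContDiffAt ℝ ∞ v z) ∧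
    -- the constant in (ii), (iii), (iv) is well defined and does not vanish
    (K₁ a b c * K₂ a b c ≠ 1 ∧ constL a b c ≠ 0) ∧
    -- (i)
    (α < 1 / 2 →
      Tendsto (fun z => dz v z) (𝓝[≠] 0) (𝓝 ((β / 2 - a * b / c : ℝ) : ℂ))) ∧
    -- (ii)
    (α = 1 / 2 →
      (fun z => dz v z - (((β / 2 - 2 * a * b : ℝ) : ℂ) -
          ((2 * constL a b c : ℝ) : ℂ) * (starRingEnd ℂ z / (‖z‖ : ℂ))))
        =O[𝓝[≠] (0 : ℂ)] fun z => ‖z‖ ^ (1 / 2 : ℝ)) ∧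
    -- (iii)
    (∀ n : ℕ, 1 ≤ n → (2 ≤ n ∨ 1 / 2 < α) →
      Tendsto (fun z => z ^ n * ((‖z‖ ^ (2 * α - 2) : ℝ) : ℂ) * dz^[n] v z) (𝓝[≠] 0)
        (𝓝 (((-1) ^ n * (ascPochhammer ℝ (n - 1)).eval c / (1 - c) * constL a b c : ℝ) : ℂ))) ∧
    -- (iv)
    (∀ m n : ℕ, 1 ≤ m → 1 ≤ n →
      Tendsto (fun z => starRingEnd ℂ z ^ m * z ^ n * ((‖z‖ ^ (2 * α - 2) : ℝ) : ℂ) *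
          dzbar^[m] (dz^[n] v) z) (𝓝[≠] 0)
        (𝓝 (((-1) ^ (m + n + 1) * (ascPochhammer ℝ (n - 1)).eval c *
          (ascPochhammer ℝ (m - 1)).eval c * constL a b c : ℝ) : ℂ))) := by
  subst hc
  have ha0 : 0 < a := by rw [ha, parA]; linarith
  have hb0 : 0 < b := by rw [hb, parB]; linarith
  have hβe : a + b - c + 1 = β := by rw [ha, hb, parA, parB]; ring
  have hab : a + b < c := by linarith
  have hs : 0 < 1 - c := sub_pos.2 hα'
  have hs0 : ((1 - c : ℝ) : ℂ) ≠ 0 := Complex.ofReal_ne_zero.2 hs.ne'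
  have hdens : hypDensity c β γ = extendFrom doubleSlit
      (fun z => 1 / (‖z‖ ^ c * ‖1 - z‖ ^ (a + b - c + 1)) * (K₃ a b c / hypM a b c z)) := by
    rw [hβe, ha, hb]
    rfl
  have hev := eventually_hypDensity_eq ha0 hb0 hab hα'
  have hpos : ∀ᶠ z in 𝓝[≠] (0 : ℂ), 0 < hypDensity c β γ z := by
    filter_upwards [hev] with z hz
    obtain ⟨h1, h2, h3, h4, -, -, h5⟩ := hz
    rw [hdens]
    exact (log_density_eq ha0 hb0 hab hα' h1 h2 h3 h4 h5).1
  have hveq : v =ᶠ[𝓝[≠] 0] fun z =>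
      ((smoothPart a b c z).re : ℂ) - (Real.log (1 + singularTerm a b c z) : ℂ) := by
    filter_upwards [hev] with z hz
    obtain ⟨h1, h2, h3, h4, -, -, h5⟩ := hz
    subst hv
    simp only [remV]
    rw [hdens, (log_density_eq ha0 hb0 hab hα' h1 h2 h3 h4 h5).2]
    push_cast
    rfl
  have hH := analyticAt_smoothPart ha0 hb0 hab
  have hH0 := deriv_smoothPart_zero ha0 hb0 hab
  have hu := hasNormPowForm_singularTerm ha0 hb0 hab hα'
  have hexp : 2 * c - 2 = -(2 * (1 - c)) := by ring
  have hβc : (a + b - c + 1 : ℂ) = β := by rw [← hβe]; push_cast; rfl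
  refine ⟨?_, ⟨(K₁_mul_K₂_lt_one ha0 hb0 hab hα').ne, constL_ne_zero ha0 hb0 hab hα'⟩, ?_, ?_, ?_, ?_⟩
  · filter_upwards [hpos, hev, eventually_eventually_nhds_of_punctured hveq] with z hz hz' hz''
    obtain ⟨-, -, -, h4, h5, h6, -⟩ := hz'
    refine ⟨hz, ContDiffAt.congr_of_eventuallyEq ?_ hz''⟩
    exact (Complex.ofRealCLM.contDiff.contDiffAt.comp z
      (Complex.reCLM.contDiff.contDiffAt.comp z h5)).sub
      (Complex.ofRealCLM.contDiff.contDiffAt.comp z ((contDiffAt_const.add h6).log h4.ne'))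
  · intro h
    have := remainder_tendsto_of_half_lt (by linarith) hH hu hveq
    rw [hH0, hβc] at this
    convert this using 2
    push_cast
    ring
  · intro h
    have hs2 : 1 - c = 1 / 2 := by linarith
    rw [hs2] at hu
    have := remainder_isBigO_of_eq_half hH hu hveq
    rw [hH0, hβc] at this
    refine this.congr_left fun z => ?_
    rw [h]
    push_cast
    ring
  · rintro n hn hn'
    obtain ⟨n, rfl⟩ := Nat.exists_eq_add_of_le' hn
    -- The order is now n + 1, one ∂ having been spent on the logarithm. The requirement 2(1 - c) <
    -- n + 1 holds because c > 0 when the order is at least 2, and because c > 1/2 otherwise.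
    have := remainder_tendsto_iterate_dz hs hH hu hveq (n := n) (by
      push_cast
      rcases hn' with h | h
      · have : (2 : ℝ) ≤ (n + 1 : ℕ) := by exact_mod_cast h
        push_cast at this
        linarith
      · linarith [n.cast_nonneg (α := ℝ)])
    rw [hexp, Nat.add_sub_cancel]
    convert this using 2
    rw [sub_sub_cancel]
    push_cast at hs0 ⊢
    field_simp
    ring
  · rintro m n hm hn
    obtain ⟨m, rfl⟩ := Nat.exists_eq_add_of_le' hm
    obtain ⟨n, rfl⟩ := Nat.exists_eq_add_of_le' hn
    have := remainder_tendsto_iterate_dzbar_dz hs hH hu hveq m n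
    rw [hexp, Nat.add_sub_cancel, Nat.add_sub_cancel]
    convert this using 2
    rw [sub_sub_cancel]
    push_cast at hs0 ⊢
    field_simp
    ring
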